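/- **Theorem (almost representation theorem).** *Setting.* Let $G \rightrightarrows X$ be a topological groupoid with source and target maps $s,t$, where $gh$ is defined when $sg=th$, with $G$ locally compact Hausdorff. Write $G^x=t^{-1}(x)$, and $Gx=\{tg : sg=x\}$ for the orbit of $x$. Suppose $G$ has a Haar measure system, i.e. Radon measures $\mu^x$ on $G$ ($x\in X$) with support $G^x$, such that for all $\varphi\in C_c(G)$ one has $\int\varphi(gh)\,d\mu^{sg}(h)=\int\varphi(h)\,d\mu^{tg}(h)$ for all $g \in G$, and $x\mapsto\int\varphi\,d\mu^x$ is continuous. Suppose $G$ is *proper*: there is a continuous $c:X\to\mathbb R_{\ge0}$ such that $\operatorname{supp}(c\circ s)\cap t^{-1}(C)$ is compact for every compact $C\subset X$ and every orbit meets $\{c>0\}$. A *Banach bundle* over $X$ is a continuous open surjection $p:E\to X$ of Hausdorff spaces whose fibers $E_x$ are real Banach spaces, such that fiberwise addition, real scalar multiplication and the norm are continuous on $E$, and such that $e_i\to 0\in E_x$ for each net $(e_i)$ in $E$ with $pe_i\to x$ and $|e_i|\to0$. Let $A\to X$ be a Banach bundle whose fibers are unital Banach algebras ($|ab|\le|a||b|$,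 $|1|=1$) with fiberwise product and unit section continuous, on which $G$ acts continuously by isometric algebra isomorphisms $A_{sg}\to A_{tg}$, $a\mapsto ga$. Let $E\to X$ be a Banach $A$-module bundle: a Banach bundle with a continuous operation of $A$ making each $E_x$ a unital left Banach $A_x$-module, $|ae|\le|a||e|$. Let $\sigma$ be an $A$-valued multiplier: a continuous family of invertible central elements $\sigma(g,h)\in A_{tg}$, defined for $sg=th$, with $\sigma(g,h)=1$ whenever $g$ or $h$ is a unit, and $\sigma(g,h)\sigma(gh,k)=g\sigma(h,k)\,\sigma(g,hk)$. A *pseudorepresentation* is a continuous map $T:s^*E\to t^*E$ over $G$ given by bounded linear operators $T(g):E_{sg}\to E_{tg}$. It is *$A$-linear* if $T(g)(ae)=ga\cdot T(g)e$. It is a *$\sigma$-representation* if in addition $T(1x)=\mathrm{id}$ and $\sigma(g,h)T(gh)=T(g)T(h)$ for all $x \in X$ and all composable $g,h$. With $\ell(\sigma,g)=\max\{1,|\sigma(g,g^{-1})^{-1}|\}$, put, for $x\in X$, in $[0,\infty]$, $$r(T,x)=\sup_{y\in Gx}\|\mathrm{id}-T(1y)\|+\sup_{tg\in Gx,\;th=sg}\ell(\sigma,g)\,\|\sigma(g,h)T(gh)-T(g)T(h)\|,\qquad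 b(T,x)=\sup_{tg\in Gx}\ell(\sigma,g)\,\|T(g)\|.$$ An *almost $\sigma$-representation* is an $A$-linear pseudorepresentation with $r(T,x)\le\min\{1/4,\;b(T,x)^{-2}/9\}$ for every $x\in X$ (where $\infty^{-2}=0$ and $0^{-2}=\infty$). For a Banach space $\boldsymbol E$, a *local trivialization* of $E$ by $\boldsymbol E$ over an open $U\subset X$ is an isomorphism of Banach bundles $U\times\boldsymbol E\cong E|_U$ under which the operation of $A|_U$ becomes a map $A|_U\to\operatorname{End}(\boldsymbol E)$ that is continuous for the operator norm. A *$GI(\boldsymbol E)$-structure* on $E$ is given by an atlas of isometric local trivializations whose transition functions are continuous for the operator norm; it pulls back along $s$ and $t$ to structures on $s^*E$ and $t^*E$. A pseudorepresentation is *uniformly continuous* with respect to it if, for every open $W\subset G$ and all trivializations of $s^*E|_W$ and $t^*E|_W$ whose transition functions to the charts of these pulled back structures are operator-norm continuous, its local matrix expression $W\to\mathcal L(\boldsymbol E,\boldsymbol E)$ is operator-norm continuous. *Claim.* Let $T$ be an almost $\sigma$-representation of the proper groupoid $G\rightrightarrows X$ on $E$. Then there is a $\sigma$-representation $R$ on $E$,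 which is a (bicontinuous) isomorphism $s^*E\cong t^*E$, such that $$\|R(g)-T(g)\|\le 4\,b(T,tg)\,r(T,tg)\qquad\text{for all }g\in G$$ (where $\infty\cdot0=0$). Moreover, if $T$ is uniformly continuous with respect to a given $GI(\boldsymbol E)$-structure on $E$, then such an $R$ can be chosen that is in addition uniformly continuous with respect to the same $GI(\boldsymbol E)$-structure. -/

import Mathlib

open CategoryTheory MeasureTheory Topology Bundle
open scoped ENNReal

namespace GroupoidRep

noncomputable section

/-! ## Topological groupoids

A groupoid `G ⇉ X` is a `CategoryTheory.Groupoid` structure on the type `X` of base points: the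
arrows `g` with source `x` and target `y` are the elements of `x ⟶ y`, and the product `g h`
(first `h`, then `g`) is `h ≫ g`. -/

/-- The space `G` of all arrows of a groupoid with base `X`: the source of `g` is `g.left`, and
its target is `g.right`. -/
abbrev Arr (X : Type*) [Groupoid X] := Quiver.Total X

/-- The set of composable pairs of arrows `(fst, snd)`: the source `y` of `fst` is the target
of `snd`. -/
structure CompPair (X : Type*) [Groupoid X] where
  {x : X}
  {y : X}
  {z : X}
  fst : y ⟶ z
  snd : x ⟶ y

/-- The set of composable pairs as a subset of `G × G`. -/
def CompPair.toProd {X : Type*} [Groupoid X] (p : CompPair X) : Arr X × Arr X :=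
  (⟨p.y, p.z, p.fst⟩, ⟨p.x, p.y, p.snd⟩)

/-- The set of composable pairs carries the subspace topology of `G × G`. -/
instance CompPair.instTopologicalSpace {X : Type*} [Groupoid X] [TopologicalSpace (Arr X)] :
    TopologicalSpace (CompPair X) :=
  TopologicalSpace.induced CompPair.toProd inferInstance

/-- Topological groupoids. -/
structure IsTopologicalGroupoid (X : Type*) [Groupoid X] [TopologicalSpace X]
    [TopologicalSpace (Arr X)] : Prop where
  continuous_source : Continuous fun g : Arr X => g.left
  continuous_target : Continuous fun g : Arr X => g.right
  continuous_unit : Continuous fun x : X => (⟨x, x, 𝟙 x⟩ : Arr X)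
  continuous_comp : Continuous fun p : CompPair X => (⟨p.x, p.z, p.snd ≫ p.fst⟩ : Arr X)
  continuous_inv : Continuous fun g : Arr X => (⟨g.right, g.left, Groupoid.inv g.hom⟩ : Arr X)

open Classical in
/-- The function `h ↦ φ (g h)` on the target fiber over the source `x` of `g`, extended by zero to
the space of all arrows. -/
def leftTranslate {X : Type*} [Groupoid X] {x y : X} (g : x ⟶ y) (φ : Arr X → ℝ) : Arr X → ℝ :=
  fun h => if hx : h.right = x then φ ⟨h.left, y, h.hom ≫ eqToHom hx ≫ g⟩ else 0

/-- Continuous left invariant Haar measure systems `μ = {μ x}`. -/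
structure IsHaarSystem {X : Type*} [Groupoid X] [TopologicalSpace X] [TopologicalSpace (Arr X)]
    [MeasurableSpace (Arr X)] [BorelSpace (Arr X)] (μ : X → Measure (Arr X)) : Prop where
  /-- Each `μ x` is a Radon measure. -/
  regular : ∀ x, (μ x).Regular
  support_eq : ∀ x, (μ x).support = {g : Arr X | g.right = x}
  left_invariant : ∀ {x y : X} (g : x ⟶ y) (φ : Arr X → ℝ), Continuous φ → HasCompactSupport φ →
    ∫ h, leftTranslate g φ h ∂(μ x) = ∫ h, φ h ∂(μ y)
  continuous_integral : ∀ φ : Arr X → ℝ, Continuous φ → HasCompactSupport φ →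
    Continuous fun x => ∫ h, φ h ∂(μ x)

/-- Locally compact groupoids: topological groupoids with a locally compact Hausdorff space of
arrows that possess a Haar measure system. -/
structure IsLocallyCompactGroupoid (X : Type*) [Groupoid X] [TopologicalSpace X]
    [TopologicalSpace (Arr X)] [MeasurableSpace (Arr X)] [BorelSpace (Arr X)] : Prop
    extends IsTopologicalGroupoid X where
  t2Space : T2Space (Arr X)
  locallyCompactSpace : LocallyCompactSpace (Arr X)
  exists_haarSystem : ∃ μ : X → Measure (Arr X), IsHaarSystem μ

/-- Cutoff functions for a groupoid. -/
structure IsCutoff {X : Type*} [Groupoid X] [TopologicalSpace X] [TopologicalSpace (Arr X)]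
    (c : X → ℝ) : Prop where
  nonneg : ∀ x, 0 ≤ c x
  continuous : Continuous c
  isCompact_tsupport_inter : ∀ C : Set X, IsCompact C →
    IsCompact (tsupport (fun g : Arr X => c g.left) ∩ {g : Arr X | g.right ∈ C})
  /-- Every orbit meets the set where `c > 0`. -/
  exists_pos : ∀ x : X, ∃ y : X, Nonempty (x ⟶ y) ∧ 0 < c y

/-- Proper groupoids: locally compact groupoids that admit cutoff functions. -/
structure IsProperGroupoid (X : Type*) [Groupoid X] [TopologicalSpace X]
    [TopologicalSpace (Arr X)] [MeasurableSpace (Arr X)] [BorelSpace (Arr X)] : Prop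
    extends IsLocallyCompactGroupoid X where
  exists_cutoff : ∃ c : X → ℝ, IsCutoff c

/-! ## Banach bundles -/

/-- The total space of a family of spaces. -/
abbrev Tot {X : Type*} (E : X → Type*) := TotalSpace Unit E

/-- The total space of the pullback of the family `E` along `u : Y → X`; when `E` is a bundle this
carries the subspace topology of `Y × Tot E`. In particular, for `Y = Tot F` and `u` the bundle
projection, this is the fiber product of `F` and `E`. -/
abbrev Pull {X Y : Type*} (u : Y → X) (E : X → Type*) := TotalSpace Unit (u *ᵖ E)

/-- The vector over the point `u p.proj` that is given by a point `p` of a pullback. -/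
abbrev vec {X Y : Type*} {u : Y → X} {E : X → Type*} (p : Pull u E) : E (u p.proj) := p.snd

/-- (Real) Banach bundles. The norm topology is used on the individual fibers. The last condition
says that `e i → 0` in the fiber over `x` whenever `e i` is a net in the total space such that the
base points of `e i` converge to `x` and `‖e i‖ → 0`; it implies the continuity of the zero section.
The continuity of the negation follows from `continuous_smul`. -/
structure IsBanachBundle {X : Type*} [TopologicalSpace X] (E : X → Type*)
    [∀ x, NormedAddCommGroup (E x)] [∀ x, NormedSpace ℝ (E x)] [TopologicalSpace (Tot E)] :
    Prop where
  completeSpace : ∀ x, CompleteSpace (E x)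
  t2Space_base : T2Space X
  t2Space_total : T2Space (Tot E)
  continuous_proj : Continuous fun e : Tot E => e.proj
  isOpenMap_proj : IsOpenMap fun e : Tot E => e.proj
  continuous_add : Continuous fun p : Pull (fun e : Tot E => e.proj) E =>
    (⟨p.proj.proj, p.proj.snd + vec p⟩ : Tot E)
  continuous_smul : Continuous fun p : ℝ × Tot E => (⟨p.2.proj, p.1 • p.2.snd⟩ : Tot E)
  continuous_norm : Continuous fun e : Tot E => ‖e.snd‖
  comap_nhds_le : ∀ x : X,
    Filter.comap (fun e : Tot E => (e.proj, ‖e.snd‖)) (𝓝 (x, (0 : ℝ))) ≤ 𝓝 (⟨x, 0⟩ : Tot E)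

/-- Banach algebra bundles; the Banach algebras are unital with `‖a b‖ ≤ ‖a‖ ‖b‖`, `‖1‖ = 1`. -/
structure IsBanachAlgebraBundle {X : Type*} [TopologicalSpace X] (A : X → Type*)
    [∀ x, NormedRing (A x)] [∀ x, NormOneClass (A x)] [∀ x, NormedAlgebra ℝ (A x)]
    [TopologicalSpace (Tot A)] : Prop extends IsBanachBundle A where
  continuous_mul : Continuous fun p : Pull (fun a : Tot A => a.proj) A =>
    (⟨p.proj.proj, p.proj.snd * vec p⟩ : Tot A)
  continuous_one : Continuous fun x : X => (⟨x, 1⟩ : Tot A)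

/-- Banach module bundles for a Banach algebra bundle `A`; `IsBoundedSMul` is the condition
`‖a e‖ ≤ ‖a‖ ‖e‖` in each fiber, and `IsScalarTower` says that the module operation of each fiber
is compatible with the real scalars. -/
structure IsBanachModuleBundle {X : Type*} [TopologicalSpace X] (A : X → Type*)
    [∀ x, NormedRing (A x)] [∀ x, NormOneClass (A x)] [∀ x, NormedAlgebra ℝ (A x)]
    [TopologicalSpace (Tot A)] (E : X → Type*) [∀ x, NormedAddCommGroup (E x)]
    [∀ x, NormedSpace ℝ (E x)] [∀ x, Module (A x) (E x)] [∀ x, IsBoundedSMul (A x) (E x)]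
    [∀ x, IsScalarTower ℝ (A x) (E x)] [TopologicalSpace (Tot E)] : Prop
    extends IsBanachBundle E where
  continuous_smul' : Continuous fun p : Pull (fun a : Tot A => a.proj) E =>
    (⟨p.proj.proj, p.proj.snd • vec p⟩ : Tot E)

/-! ## Groupoid operations and multipliers -/

/-- Continuous left operations of a groupoid on a Banach algebra bundle by isometric isomorphisms
of algebras; a Banach algebra bundle with such an operation is a Banach algebra `G`-bundle. -/
structure AlgebraAction {X : Type*} [Groupoid X] [TopologicalSpace (Arr X)] (A : X → Type*)
    [∀ x, NormedRing (A x)] [∀ x, NormedAlgebra ℝ (A x)] [TopologicalSpace (Tot A)] where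
  act : ∀ ⦃x y : X⦄, (x ⟶ y) → (A x ≃ₐ[ℝ] A y)
  norm_act : ∀ ⦃x y : X⦄ (g : x ⟶ y) (a : A x), ‖act g a‖ = ‖a‖
  act_id : ∀ (x : X) (a : A x), act (𝟙 x) a = a
  act_comp : ∀ ⦃x y z : X⦄ (g : y ⟶ z) (h : x ⟶ y) (a : A x), act (h ≫ g) a = act g (act h a)
  continuous_act : Continuous fun p : Pull (fun g : Arr X => g.left) A =>
    (⟨p.proj.right, act p.proj.hom (vec p)⟩ : Tot A)

/-- Multipliers with values in a Banach algebra `G`-bundle. -/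
structure Multiplier {X : Type*} [Groupoid X] [TopologicalSpace (Arr X)] {A : X → Type*}
    [∀ x, NormedRing (A x)] [∀ x, NormedAlgebra ℝ (A x)] [TopologicalSpace (Tot A)]
    (α : AlgebraAction A) where
  toFun : ∀ ⦃x y z : X⦄, (y ⟶ z) → (x ⟶ y) → (A z)ˣ
  continuous_toFun : Continuous fun p : CompPair X =>
    (⟨p.z, (toFun p.fst p.snd : A p.z)⟩ : Tot A)
  central : ∀ ⦃x y z : X⦄ (g : y ⟶ z) (h : x ⟶ y) (a : A z),
    (toFun g h : A z) * a = a * (toFun g h : A z)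
  normal_left : ∀ ⦃x y : X⦄ (h : x ⟶ y), toFun (𝟙 y) h = 1
  normal_right : ∀ ⦃x y : X⦄ (g : x ⟶ y), toFun g (𝟙 x) = 1
  cocycle : ∀ ⦃w x y z : X⦄ (g : y ⟶ z) (h : x ⟶ y) (k : w ⟶ x),
    (toFun g h : A z) * (toFun (h ≫ g) k : A z) =
      α.act g (toFun h k : A y) * (toFun g (k ≫ h) : A z)

instance {X : Type*} [Groupoid X] [TopologicalSpace (Arr X)] {A : X → Type*}
    [∀ x, NormedRing (A x)] [∀ x, NormedAlgebra ℝ (A x)] [TopologicalSpace (Tot A)]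
    (α : AlgebraAction A) :
    CoeFun (Multiplier α) fun _ => ∀ ⦃x y z : X⦄, (y ⟶ z) → (x ⟶ y) → (A z)ˣ :=
  ⟨Multiplier.toFun⟩

/-! ## Pseudorepresentations -/

/-- Pseudorepresentations: fiberwise linear continuous maps from the pullback of `E` along the
source map to the pullback of `E` along the target map, covering the identity of the space of
arrows. -/
structure Pseudorep {X : Type*} [Groupoid X] [TopologicalSpace (Arr X)] (E : X → Type*)
    [∀ x, NormedAddCommGroup (E x)] [∀ x, NormedSpace ℝ (E x)] [TopologicalSpace (Tot E)] where
  toFun : ∀ ⦃x y : X⦄, (x ⟶ y) → (E x →L[ℝ] E y)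
  continuous_toFun : Continuous fun p : Pull (fun g : Arr X => g.left) E =>
    (⟨p.proj, toFun p.proj.hom (vec p)⟩ : Pull (fun g : Arr X => g.right) E)

instance {X : Type*} [Groupoid X] [TopologicalSpace (Arr X)] (E : X → Type*)
    [∀ x, NormedAddCommGroup (E x)] [∀ x, NormedSpace ℝ (E x)] [TopologicalSpace (Tot E)] :
    CoeFun (Pseudorep E) fun _ => ∀ ⦃x y : X⦄, (x ⟶ y) → (E x →L[ℝ] E y) :=
  ⟨Pseudorep.toFun⟩

/-- The map of total spaces that is given by a pseudorepresentation. -/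
def Pseudorep.totalMap {X : Type*} [Groupoid X] [TopologicalSpace (Arr X)] {E : X → Type*}
    [∀ x, NormedAddCommGroup (E x)] [∀ x, NormedSpace ℝ (E x)] [TopologicalSpace (Tot E)]
    (T : Pseudorep E) (p : Pull (fun g : Arr X => g.left) E) :
    Pull (fun g : Arr X => g.right) E :=
  ⟨p.proj, T p.proj.hom (vec p)⟩

section

variable {X : Type*} [Groupoid X] [TopologicalSpace (Arr X)] {A : X → Type*}
  [∀ x, NormedRing (A x)] [∀ x, NormedAlgebra ℝ (A x)] [TopologicalSpace (Tot A)]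
  {E : X → Type*} [∀ x, NormedAddCommGroup (E x)] [∀ x, NormedSpace ℝ (E x)]
  [∀ x, Module (A x) (E x)] [∀ x, IsBoundedSMul (A x) (E x)]
  [∀ x, IsScalarTower ℝ (A x) (E x)] [TopologicalSpace (Tot E)]
  {α : AlgebraAction A}

/-- `A`-linearity of a pseudorepresentation. -/
def Pseudorep.IsLinear (α : AlgebraAction A) (T : Pseudorep E) : Prop :=
  ∀ ⦃x y : X⦄ (g : x ⟶ y) (a : A x) (e : E x), T g (a • e) = α.act g a • T g e

/-- `σ`-representations. -/
structure Pseudorep.IsRepresentation (σ : Multiplier α) (R : Pseudorep E) : Prop where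
  isLinear : R.IsLinear α
  map_id : ∀ x : X, R (𝟙 x) = ContinuousLinearMap.id ℝ (E x)
  map_comp : ∀ ⦃x y z : X⦄ (g : y ⟶ z) (h : x ⟶ y),
    (σ g h : A z) • R (h ≫ g) = (R g).comp (R h)

/-- `ℓ(σ, g) = max {1, |σ(g, g⁻¹)⁻¹|}`. -/
def Multiplier.ell (σ : Multiplier α) {x y : X} (g : x ⟶ y) : ℝ≥0∞ :=
  max 1 ‖(((σ g (Groupoid.inv g))⁻¹ : (A y)ˣ) : A y)‖ₑ

/-- The `σ`-defect of `T` along the orbit of `x`; the points of that orbit are the targets `z` of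
the arrows `x ⟶ z`. -/
def Pseudorep.defect (σ : Multiplier α) (T : Pseudorep E) (x : X) : ℝ≥0∞ :=
  (⨆ (y : X) (_ : Nonempty (x ⟶ y)), ‖ContinuousLinearMap.id ℝ (E y) - T (𝟙 y)‖ₑ) +
    ⨆ (z : X) (_ : Nonempty (x ⟶ z)) (y : X) (g : y ⟶ z) (w : X) (h : w ⟶ y),
      σ.ell g * ‖(σ g h : A z) • T (h ≫ g) - (T g).comp (T h)‖ₑ

/-- The `σ`-bound of `T` along the orbit of `x`. -/
def Pseudorep.bound (σ : Multiplier α) (T : Pseudorep E) (x : X) : ℝ≥0∞ :=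
  ⨆ (z : X) (_ : Nonempty (x ⟶ z)) (y : X) (g : y ⟶ z), σ.ell g * ‖T g‖ₑ

/-- Almost `σ`-representations. -/
structure Pseudorep.IsAlmostRepresentation (σ : Multiplier α) (T : Pseudorep E) : Prop where
  isLinear : T.IsLinear α
  defect_le : ∀ x : X, T.defect σ x ≤ min (1 / 4) ((T.bound σ x ^ 2)⁻¹ / 9)

end

/-! ## Local triviality and uniform continuity -/

/-- Local trivializations of a Banach `A`-module bundle `E` by a Banach space `V` over an open set
`baseSet`. -/
structure LocalTrivialization {X : Type*} [TopologicalSpace X] (A : X → Type*)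
    [∀ x, NormedRing (A x)] [∀ x, NormedAlgebra ℝ (A x)]
    [TopologicalSpace (Tot A)] (E : X → Type*) [∀ x, NormedAddCommGroup (E x)]
    [∀ x, NormedSpace ℝ (E x)] [∀ x, Module (A x) (E x)] [∀ x, IsBoundedSMul (A x) (E x)]
    [∀ x, IsScalarTower ℝ (A x) (E x)] [TopologicalSpace (Tot E)]
    (V : Type*) [NormedAddCommGroup V] [NormedSpace ℝ V] where
  baseSet : Set X
  isOpen_baseSet : IsOpen baseSet
  equiv : ∀ x : baseSet, V ≃L[ℝ] E x
  continuous_equiv : Continuous fun p : baseSet × V => (⟨p.1, equiv p.1 p.2⟩ : Tot E)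
  continuous_symm : Continuous fun e : {e : Tot E // e.proj ∈ baseSet} =>
    (equiv ⟨e.1.proj, e.2⟩).symm e.1.snd
  /-- The scalar multiplication by elements of `A` is continuous for the operator norm on the
  endomorphisms of `V`. -/
  continuous_scalar : Continuous fun a : {a : Tot A // a.proj ∈ baseSet} =>
    ((equiv ⟨a.1.proj, a.2⟩).symm : E a.1.proj →L[ℝ] V).comp
      ((a.1.snd • ContinuousLinearMap.id ℝ (E a.1.proj)).comp
        (equiv ⟨a.1.proj, a.2⟩ : V →L[ℝ] E a.1.proj))

/-- A `GI(V)`-structure on a Banach `A`-module bundle, given by an atlas of isometric local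
trivializations whose transition functions are continuous for the operator norm. (Two such atlases
define the same structure iff their union is one again; uniform continuity, as defined below, does
not distinguish between such atlases.) -/
structure GIStructure {X : Type*} [TopologicalSpace X] (A : X → Type*)
    [∀ x, NormedRing (A x)] [∀ x, NormedAlgebra ℝ (A x)]
    [TopologicalSpace (Tot A)] (E : X → Type*) [∀ x, NormedAddCommGroup (E x)]
    [∀ x, NormedSpace ℝ (E x)] [∀ x, Module (A x) (E x)] [∀ x, IsBoundedSMul (A x) (E x)]
    [∀ x, IsScalarTower ℝ (A x) (E x)] [TopologicalSpace (Tot E)]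
    (V : Type*) [NormedAddCommGroup V] [NormedSpace ℝ V] where
  atlas : Set (LocalTrivialization A E V)
  covers : ∀ x : X, ∃ φ ∈ atlas, x ∈ φ.baseSet
  isometric : ∀ φ ∈ atlas, ∀ (x : φ.baseSet) (v : V), ‖φ.equiv x v‖ = ‖v‖
  compatible : ∀ φ ∈ atlas, ∀ ψ ∈ atlas,
    Continuous fun x : {x : X // x ∈ φ.baseSet ∧ x ∈ ψ.baseSet} =>
      ((ψ.equiv ⟨x.1, x.2.2⟩).symm : E x.1 →L[ℝ] V).comp
        (φ.equiv ⟨x.1, x.2.1⟩ : V →L[ℝ] E x.1)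

section

variable {X : Type*} [TopologicalSpace X] {A : X → Type*}
  [∀ x, NormedRing (A x)] [∀ x, NormedAlgebra ℝ (A x)] [TopologicalSpace (Tot A)]
  {E : X → Type*} [∀ x, NormedAddCommGroup (E x)] [∀ x, NormedSpace ℝ (E x)]
  [∀ x, Module (A x) (E x)] [∀ x, IsBoundedSMul (A x) (E x)]
  [∀ x, IsScalarTower ℝ (A x) (E x)] [TopologicalSpace (Tot E)]
  {V : Type*} [NormedAddCommGroup V] [NormedSpace ℝ V]

/-- The local trivializations `φ`, over an open subset `W` of `Y`, of the pullback of `E` along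
`u : Y → X` which are of class `C⁰` relative to the pulled back `GI(V)`-structure: those whose
transition functions to the pullbacks of the charts of the structure are continuous for the operator
norm. (All the other properties of a local trivialization follow from this one.) -/
def GIStructure.IsPullbackTrivialization (S : GIStructure A E V) {Y : Type*} [TopologicalSpace Y]
    (u : Y → X) (W : Set Y) (φ : ∀ w : W, V ≃L[ℝ] E (u w)) : Prop :=
  IsOpen W ∧ ∀ ψ ∈ S.atlas,
    Continuous fun w : {w : Y // w ∈ W ∧ u w ∈ ψ.baseSet} =>
      ((ψ.equiv ⟨u w.1, w.2.2⟩).symm : E (u w.1) →L[ℝ] V).comp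
        (φ ⟨w.1, w.2.1⟩ : V →L[ℝ] E (u w.1))

/-- Uniform continuity of a pseudorepresentation relative to a `GI(V)`-structure: for each pair of
local trivializations `φ`, `ψ` of class `C⁰`, over an open set `W` of arrows, of the pullbacks of
`E` along the source and the target map, the local matrix expression of `T` is continuous for the
operator norm. -/
def Pseudorep.IsUniformlyContinuous [Groupoid X] [TopologicalSpace (Arr X)]
    (S : GIStructure A E V) (T : Pseudorep E) : Prop :=
  ∀ (W : Set (Arr X)) (φ : ∀ g : W, V ≃L[ℝ] E g.1.left) (ψ : ∀ g : W, V ≃L[ℝ] E g.1.right),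
    S.IsPullbackTrivialization (fun g : Arr X => g.left) W φ →
    S.IsPullbackTrivialization (fun g : Arr X => g.right) W ψ →
    Continuous fun g : W => ((ψ g).symm : E g.1.right →L[ℝ] V).comp
      ((T g.1.hom).comp (φ g : V →L[ℝ] E g.1.left))

end

end

end GroupoidRep

open GroupoidRep

namespace GroupoidRep

open Filter Set

noncomputable section

/-! ## Regular measures and closed embeddings -/

section Regular

variable {S Y : Type*} [TopologicalSpace S] [MeasurableSpace S] [BorelSpace S]
  [TopologicalSpace Y] [MeasurableSpace Y] [BorelSpace Y] {f : S → Y}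

/-! The representation is found by an iteration of Newton type. A cutoff function turns the Haar
system into left invariant probability measures on the target fibers (`cutoffMean`), and `T` is
replaced by its average `R(g) = ∫ q(g, h) dh` over the arrows `h` with target `s g`, where `q(g, h)
= σ(g, h) T(gh) T(h)⁻¹`. The inverse exists because `r ≤ 1/4` makes `σ(g, g⁻¹)⁻¹ T(g) T(g⁻¹)` a
small perturbation of the identity (`Pseudorep.exists_inverse_comp_inv`).

The quotients are exactly multiplicative, `q(g, hk) q(h, k) = σ(g, h) q(gh, k)`
(`Pseudorep.quotient_quotient`), and differ from `T(g)` by `O(b r)`. By left invariance the defect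
of `R` is a covariance: the mean of `(q(g, hk) - T(g)) (q(h, k) - T(h))` minus the product of the
means of the two factors (`Pseudorep.average_comp_apply`). Hence it is of order `(b r)²`. The
condition `b² r ≤ 1/9` converts this into a contraction by `3/5` of both `r` and `b r`, and is
itself preserved (`enorm_average_estimates`). The iterates converge uniformly on all of `G`, their
defects tend to zero, and the sum of the steps gives the factor `4`.

The analytic difficulty is continuity of the average on the total space, without local triviality.
Openness of the bundle projection supplies, along a finer filter, a family of vectors converging to
each vector of a given fiber (`IsBanachBundle.tendsto_of_sections`); such a family is asymptotically
linear and isometric, and this suffices for approximating integrals by finite sums with a partition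
of unity (`InvariantMean.tendsto_integral`). The same integral lemma, applied to the constant bundle
of operators on `V`, gives operator norm continuity of the averaged matrix expressions, so one and
the same `R` serves both parts of the theorem. -/

theorem regular_comap_of_isClosedEmbedding (hf : IsClosedEmbedding f) (μ : Measure Y)
    [μ.Regular] (hr : μ (range f)ᶜ = 0) : (μ.comap f).Regular := by
  have hm := hf.measurableEmbedding
  have := Measure.OuterRegular.comap' μ hf.continuous hm
  refine { lt_top_of_isCompact := fun K hK => ?_, innerRegular := fun U hU r hr' => ?_ }
  · rw [hm.comap_apply]
    exact (hK.image hf.continuous).measure_lt_top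
  · obtain ⟨O, hO, rfl⟩ := hf.isInducing.isOpen_iff.1 hU
    have hOr : ∀ B : Set Y, μ (B ∩ range f) = μ B := fun B =>
      measure_inter_conull hr
    rw [hm.comap_apply, image_preimage_eq_inter_range, hOr] at hr'
    obtain ⟨K, hKO, hK, hrK⟩ := hO.exists_lt_isCompact hr'
    refine ⟨f ⁻¹' K, preimage_mono hKO, hf.isCompact_preimage hK, ?_⟩
    rwa [hm.comap_apply, image_preimage_eq_inter_range, hOr]

/-- Regularity of pushforwards is what allows `IsHaarSystem.map_mulLeft` to compare measures on `G`
through integrals of compactly supported functions. -/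
theorem regular_map_of_isClosedEmbedding (hf : IsClosedEmbedding f) (m : Measure S)
    [m.Regular] : (m.map f).Regular := by
  have hm := hf.measurableEmbedding
  refine { lt_top_of_isCompact := fun K hK => ?_, outerRegular := fun B hB r hr => ?_,
           innerRegular := fun U hU r hr => ?_ }
  · rw [hm.map_apply]
    exact (hf.isCompact_preimage hK).measure_lt_top
  · rw [hm.map_apply] at hr
    obtain ⟨O, hBO, hO, hOr⟩ := Set.exists_isOpen_lt_of_lt _ r hr
    obtain ⟨O', hO', rfl⟩ := hf.isInducing.isOpen_iff.1 hO
    -- The complement of the range is open and null for the pushforward; adding it covers the part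
    -- of `B` outside the range at no cost.
    refine ⟨O' ∪ (range f)ᶜ, fun y hy => ?_, hO'.union hf.isClosed_range.isOpen_compl, ?_⟩
    · by_cases hyr : y ∈ range f
      · obtain ⟨s, rfl⟩ := hyr
        exact Or.inl (hBO hy)
      · exact Or.inr hyr
    · rw [hm.map_apply]
      convert hOr using 2
      ext s
      simp
  · rw [hm.map_apply] at hr
    obtain ⟨K, hKU, hK, hrK⟩ := (hU.preimage hf.continuous).exists_lt_isCompact hr
    refine ⟨f '' K, image_subset_iff.2 hKU, hK.image hf.continuous, ?_⟩
    rwa [hm.map_apply, preimage_image_eq _ hf.injective]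

end Regular

/-! ## Target fibers of a groupoid -/

/-- The target fiber over `x`: the arrows with target `x`. -/
structure TargetFiber (X : Type*) [Groupoid X] (x : X) where
  source : X
  hom : source ⟶ x

namespace TargetFiber

variable {X : Type*} [Groupoid X]

/-- The inclusion of a target fiber in the space of arrows. -/
def toArr {x : X} (h : TargetFiber X x) : Arr X := ⟨h.source, x, h.hom⟩

/-- Left translation by an arrow `g`. -/
def mulLeft {x y : X} (g : x ⟶ y) (h : TargetFiber X x) : TargetFiber X y :=
  ⟨h.source, h.hom ≫ g⟩

theorem toArr_injective (x : X) : Function.Injective (toArr : TargetFiber X x → Arr X) := by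
  rintro ⟨w, h⟩ ⟨w', h'⟩ e
  simp only [toArr, Quiver.Total.mk.injEq, true_and] at e
  obtain ⟨rfl, e⟩ := e
  cases e
  rfl

theorem range_toArr (x : X) :
    range (toArr : TargetFiber X x → Arr X) = {g : Arr X | g.right = x} := by
  ext ⟨w, y, g⟩
  constructor
  · rintro ⟨h, e⟩
    rw [← e]
    rfl
  · rintro rfl
    exact ⟨⟨w, g⟩, rfl⟩

variable [TopologicalSpace (Arr X)]

instance (x : X) : TopologicalSpace (TargetFiber X x) :=
  TopologicalSpace.induced toArr inferInstance

instance (x : X) : MeasurableSpace (TargetFiber X x) := borel _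

instance (x : X) : BorelSpace (TargetFiber X x) := ⟨rfl⟩

theorem continuous_toArr (x : X) : Continuous (toArr : TargetFiber X x → Arr X) :=
  continuous_induced_dom

theorem isInducing_toArr (x : X) : IsInducing (toArr : TargetFiber X x → Arr X) := ⟨rfl⟩

end TargetFiber

section Groupoid

variable {X : Type*} [Groupoid X] [TopologicalSpace X] [TopologicalSpace (Arr X)]

open TargetFiber

theorem TargetFiber.isClosedEmbedding_toArr [T2Space X] (hG : IsTopologicalGroupoid X) (x : X) :
    IsClosedEmbedding (toArr : TargetFiber X x → Arr X) := by
  refine ⟨⟨isInducing_toArr x, toArr_injective x⟩, ?_⟩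
  rw [range_toArr]
  exact isClosed_eq hG.continuous_target continuous_const

theorem IsTopologicalGroupoid.tendsto_comp (hG : IsTopologicalGroupoid X) {P : Type*}
    {l : Filter P} {x y z : P → X} {g : ∀ p, y p ⟶ z p} {h : ∀ p, x p ⟶ y p} {x₀ y₀ z₀ : X}
    {g₀ : y₀ ⟶ z₀} {h₀ : x₀ ⟶ y₀}
    (hg : Tendsto (fun p => (⟨y p, z p, g p⟩ : Arr X)) l (𝓝 ⟨y₀, z₀, g₀⟩))
    (hh : Tendsto (fun p => (⟨x p, y p, h p⟩ : Arr X)) l (𝓝 ⟨x₀, y₀, h₀⟩)) :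
    Tendsto (fun p => (⟨x p, z p, h p ≫ g p⟩ : Arr X)) l (𝓝 ⟨x₀, z₀, h₀ ≫ g₀⟩) := by
  have hp : Tendsto (fun p => (⟨g p, h p⟩ : CompPair X)) l (𝓝 ⟨g₀, h₀⟩) := by
    have : IsInducing (CompPair.toProd : CompPair X → _) := ⟨rfl⟩
    rw [this.tendsto_nhds_iff]
    exact hg.prodMk_nhds hh
  exact (hG.continuous_comp.tendsto _).comp hp

theorem IsTopologicalGroupoid.tendsto_inv (hG : IsTopologicalGroupoid X) {P : Type*}
    {l : Filter P} {y z : P → X} {g : ∀ p, y p ⟶ z p} {y₀ z₀ : X} {g₀ : y₀ ⟶ z₀}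
    (hg : Tendsto (fun p => (⟨y p, z p, g p⟩ : Arr X)) l (𝓝 ⟨y₀, z₀, g₀⟩)) :
    Tendsto (fun p => (⟨z p, y p, Groupoid.inv (g p)⟩ : Arr X)) l
      (𝓝 ⟨z₀, y₀, Groupoid.inv g₀⟩) :=
  (hG.continuous_inv.tendsto _).comp hg

theorem IsTopologicalGroupoid.tendsto_source (hG : IsTopologicalGroupoid X) {P : Type*}
    {l : Filter P} {y z : P → X} {g : ∀ p, y p ⟶ z p} {y₀ z₀ : X} {g₀ : y₀ ⟶ z₀}
    (hg : Tendsto (fun p => (⟨y p, z p, g p⟩ : Arr X)) l (𝓝 ⟨y₀, z₀, g₀⟩)) :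
    Tendsto y l (𝓝 y₀) :=
  (hG.continuous_source.tendsto _).comp hg

theorem IsTopologicalGroupoid.tendsto_target (hG : IsTopologicalGroupoid X) {P : Type*}
    {l : Filter P} {y z : P → X} {g : ∀ p, y p ⟶ z p} {y₀ z₀ : X} {g₀ : y₀ ⟶ z₀}
    (hg : Tendsto (fun p => (⟨y p, z p, g p⟩ : Arr X)) l (𝓝 ⟨y₀, z₀, g₀⟩)) :
    Tendsto z l (𝓝 z₀) :=
  (hG.continuous_target.tendsto _).comp hg

/-- The target map is a left inverse of the unit map, which therefore embeds `X` as a closed subset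
of the Hausdorff space `G`. -/
theorem IsTopologicalGroupoid.locallyCompactSpace_base (hG : IsTopologicalGroupoid X)
    [T2Space (Arr X)] [LocallyCompactSpace (Arr X)] : LocallyCompactSpace X :=
  (Function.LeftInverse.isClosedEmbedding (f := fun g : Arr X => g.right) (fun _ => rfl)
    hG.continuous_target hG.continuous_unit).locallyCompactSpace

theorem TargetFiber.continuous_mulLeft (hG : IsTopologicalGroupoid X) {x y : X} (g : x ⟶ y) :
    Continuous (mulLeft g) := by
  rw [(isInducing_toArr y).continuous_iff, continuous_iff_continuousAt]
  intro h
  exact hG.tendsto_comp (g := fun _ => g) (h := fun h : TargetFiber X x => h.hom)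
    tendsto_const_nhds ((continuous_toArr x).tendsto h)

/-- Left translation by an arrow as a homeomorphism of target fibers. -/
def TargetFiber.mulLeftHomeomorph (hG : IsTopologicalGroupoid X) {x y : X} (g : x ⟶ y) :
    TargetFiber X x ≃ₜ TargetFiber X y where
  toFun := mulLeft g
  invFun := mulLeft (Groupoid.inv g)
  left_inv h := by simp [mulLeft]
  right_inv h := by simp [mulLeft]
  continuous_toFun := continuous_mulLeft hG g
  continuous_invFun := continuous_mulLeft hG (Groupoid.inv g)

theorem TargetFiber.isClosedEmbedding_mulLeft (hG : IsTopologicalGroupoid X) {x y : X}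
    (g : x ⟶ y) : IsClosedEmbedding (mulLeft g) :=
  (mulLeftHomeomorph hG g).isClosedEmbedding

/-! ## Invariant means -/

/-- Left invariant systems of probability measures on the target fibers which have compact
supports, locally uniformly, and are continuous. -/
structure InvariantMean (X : Type*) [Groupoid X] [TopologicalSpace X]
    [TopologicalSpace (Arr X)] where
  measure : ∀ x : X, Measure (TargetFiber X x)
  isProbabilityMeasure : ∀ x, IsProbabilityMeasure (measure x)
  exists_isCompact : ∀ C : Set X, IsCompact C → ∃ K : Set (Arr X), IsCompact K ∧
    ∀ x ∈ C, ∀ᵐ h ∂(measure x), h.toArr ∈ K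
  continuous_integral : ∀ φ : Arr X → ℝ, Continuous φ →
    Continuous fun x => ∫ h, φ h.toArr ∂(measure x)
  map_mulLeft : ∀ ⦃x y : X⦄ (g : x ⟶ y), (measure x).map (mulLeft g) = measure y

theorem continuous_comp_source (hG : IsTopologicalGroupoid X) {c : X → ℝ}
    (hc : IsCutoff c) (x : X) : Continuous fun h : TargetFiber X x => c h.source :=
  hc.continuous.comp (hG.continuous_source.comp (continuous_toArr x))

theorem IsCutoff.hasCompactSupport [T2Space (Arr X)] [T2Space X]
    (hG : IsTopologicalGroupoid X) {c : X → ℝ} (hc : IsCutoff c) (x : X) :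
    HasCompactSupport fun h : TargetFiber X x => c h.source := by
  have hK := hc.isCompact_tsupport_inter {x} isCompact_singleton
  have := (isClosedEmbedding_toArr hG x).isEmbedding.t2Space
  refine HasCompactSupport.intro ((isClosedEmbedding_toArr hG x).isCompact_preimage hK) ?_
  intro h hh
  by_contra hne
  exact hh ⟨subset_tsupport (fun g : Arr X => c g.left) (show c h.source ≠ 0 from hne), rfl⟩

variable [MeasurableSpace (Arr X)] [BorelSpace (Arr X)]

/-- The restriction of a Haar system to the target fiber over `x`. -/
def fiberMeasure (μ : X → Measure (Arr X)) (x : X) : Measure (TargetFiber X x) :=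
  (μ x).comap toArr

section

variable {μ : X → Measure (Arr X)} (hμ : IsHaarSystem μ)

include hμ

theorem IsHaarSystem.compl_range_toArr (x : X) :
    μ x (range (toArr : TargetFiber X x → Arr X))ᶜ = 0 := by
  have := hμ.regular x
  rw [range_toArr, ← hμ.support_eq]
  exact Measure.measure_compl_support_of_regular

variable [T2Space X] (hG : IsTopologicalGroupoid X)

include hG

theorem IsHaarSystem.regular_fiberMeasure (x : X) : (fiberMeasure μ x).Regular := by
  have := hμ.regular x
  exact regular_comap_of_isClosedEmbedding (isClosedEmbedding_toArr hG x) _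
    (hμ.compl_range_toArr x)

theorem IsHaarSystem.map_toArr (x : X) : (fiberMeasure μ x).map toArr = μ x := by
  rw [fiberMeasure, (isClosedEmbedding_toArr hG x).measurableEmbedding.map_comap]
  exact Measure.restrict_eq_self_of_ae_mem
    (mem_ae_iff.2 (hμ.compl_range_toArr x))

theorem IsHaarSystem.integral_fiberMeasure (x : X) {V : Type*} [NormedAddCommGroup V]
    [NormedSpace ℝ V] (φ : Arr X → V) :
    ∫ h, φ h.toArr ∂(fiberMeasure μ x) = ∫ h, φ h ∂(μ x) := by
  rw [← (isClosedEmbedding_toArr hG x).measurableEmbedding.integral_map, hμ.map_toArr hG]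

/-- Invariance is given only against compactly supported functions. Pushed forward to `G`, both
sides are regular measures on a locally compact Hausdorff space, so these functions determine them;
the equality is then pulled back along the embedding of the fiber. -/
theorem IsHaarSystem.map_mulLeft [T2Space (Arr X)] [LocallyCompactSpace (Arr X)] {x y : X}
    (g : x ⟶ y) : (fiberMeasure μ x).map (mulLeft g) = fiberMeasure μ y := by
  have hy := isClosedEmbedding_toArr hG y
  have ht := isClosedEmbedding_mulLeft hG g
  have := hμ.regular_fiberMeasure hG x
  have := hμ.regular y
  have hr : (((fiberMeasure μ x).map (mulLeft g)).map toArr).Regular := by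
    have : ((fiberMeasure μ x).map (mulLeft g)).Regular :=
      regular_map_of_isClosedEmbedding ht _
    exact regular_map_of_isClosedEmbedding hy _
  have key : ((fiberMeasure μ x).map (mulLeft g)).map toArr = μ y := by
    refine Measure.ext_of_integral_eq_on_compactlySupported fun φ => ?_
    rw [hy.measurableEmbedding.integral_map, ht.measurableEmbedding.integral_map,
      ← hμ.left_invariant g φ φ.continuous φ.hasCompactSupport, ← hμ.integral_fiberMeasure hG]
    congr 1
    ext h
    simp [leftTranslate, toArr]
    rfl
  rw [← hy.measurableEmbedding.comap_map ((fiberMeasure μ x).map (mulLeft g)), key]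
  rfl

end

section

variable [T2Space (Arr X)] [LocallyCompactSpace (Arr X)] [T2Space X]
  (hG : IsTopologicalGroupoid X) {μ : X → Measure (Arr X)} (hμ : IsHaarSystem μ) {c : X → ℝ}
  (hc : IsCutoff c)

include hG hμ hc

omit [LocallyCompactSpace (Arr X)] in
theorem integrable_comp_source (x : X) :
    Integrable (fun h : TargetFiber X x => c h.source) (fiberMeasure μ x) := by
  have := hμ.regular_fiberMeasure hG x
  exact (continuous_comp_source hG hc x).integrable_of_hasCompactSupport
    (hc.hasCompactSupport hG x)

omit [LocallyCompactSpace (Arr X)] in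
-- The orbit of `x` contains some `y` with `c y > 0`, so some arrow from `y` to `x` lies in the open
-- set `c ∘ s > 0`. That arrow is in the support of `μ x`, hence the open set has positive measure.
theorem integral_comp_source_pos (x : X) : 0 < ∫ h, c h.source ∂(fiberMeasure μ x) := by
  rw [integral_pos_iff_support_of_nonneg (fun h => hc.nonneg _)
    (integrable_comp_source hG hμ hc x)]
  obtain ⟨y, ⟨g⟩, hy⟩ := hc.exists_pos x
  have hmem : (⟨y, x, Groupoid.inv g⟩ : Arr X) ∈ (μ x).support := by
    rw [hμ.support_eq]
    rfl
  have hopen : IsOpen {g : Arr X | 0 < c g.left} :=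
    isOpen_lt continuous_const (hc.continuous.comp hG.continuous_source)
  have hpos : 0 < μ x {g : Arr X | 0 < c g.left} :=
    (Measure.mem_support_iff_forall _).1 hmem _ (hopen.mem_nhds hy)
  rw [← hμ.map_toArr hG, (isClosedEmbedding_toArr hG x).measurableEmbedding.map_apply] at hpos
  exact hpos.trans_le (measure_mono fun h (hh : 0 < c h.source) => hh.ne')

/-- The integrand need not have compact support on `G`. Near `x₀` it may be multiplied by a
compactly supported function equal to `1` on `supp (c ∘ s) ∩ t⁻¹(C)`, for a compact neighborhood `C`
of `x₀`, without changing the integrals. -/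
theorem continuous_integral_mul_comp_source (φ : Arr X → ℝ) (hφ : Continuous φ) :
    Continuous fun x => ∫ h : TargetFiber X x, φ h.toArr * c h.source ∂(fiberMeasure μ x) := by
  have := hG.locallyCompactSpace_base
  rw [continuous_iff_continuousAt]
  intro x₀
  obtain ⟨C, hC, hx₀⟩ := exists_compact_mem_nhds x₀
  obtain ⟨ψ, hψ, -, hψc, -⟩ := exists_continuous_one_zero_of_isCompact
    (hc.isCompact_tsupport_inter C hC) isClosed_empty (disjoint_empty _)
  have hcont : Continuous fun g : Arr X => ψ g * (φ g * c g.left) :=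
    ψ.continuous.mul (hφ.mul (hc.continuous.comp hG.continuous_source))
  refine ((hμ.continuous_integral _ hcont hψc.mul_right).continuousAt (x := x₀)).congr ?_
  filter_upwards [hx₀] with x hx
  rw [← hμ.integral_fiberMeasure hG]
  congr 1
  ext h
  by_cases h0 : c h.source = 0
  · simp [toArr, h0]
  · have : h.toArr ∈ tsupport (fun g : Arr X => c g.left) ∩ {g : Arr X | g.right ∈ C} :=
      ⟨subset_tsupport (fun g : Arr X => c g.left) (show c h.source ≠ 0 from h0), hx⟩
    rw [hψ this]
    simp [toArr]

-- Left translation preserves sources. So the normalizing factor of the mean is constant on orbits,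
-- and normalization does not destroy invariance.
omit hc in
theorem integral_comp_source_eq {x y : X} (g : x ⟶ y) :
    ∫ h, c h.source ∂(fiberMeasure μ x) = ∫ h, c h.source ∂(fiberMeasure μ y) := by
  rw [← hμ.map_mulLeft hG g,
    (isClosedEmbedding_mulLeft hG g).measurableEmbedding.integral_map]
  rfl

/-- The left invariant mean that is associated with a cutoff function. -/
def cutoffMean : InvariantMean X where
  measure x := (fiberMeasure μ x).withDensity fun h =>
    ((c h.source).toNNReal / (∫ h, c h.source ∂(fiberMeasure μ x)).toNNReal : NNReal)
  isProbabilityMeasure x := by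
    have hpos := integral_comp_source_pos hG hμ hc x
    have hm : Measurable fun h : TargetFiber X x => (c h.source).toNNReal :=
      (continuous_comp_source hG hc x).measurable.real_toNNReal
    constructor
    rw [withDensity_apply _ MeasurableSet.univ, Measure.restrict_univ]
    have hne : (∫ h, c h.source ∂(fiberMeasure μ x)).toNNReal ≠ 0 := by simpa using hpos
    simp_rw [ENNReal.coe_div hne, div_eq_mul_inv]
    rw [lintegral_mul_const _ hm.coe_nnreal_ennreal]
    have h1 : ∫⁻ h : TargetFiber X x, ((c h.source).toNNReal : ℝ≥0∞) ∂(fiberMeasure μ x) =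
        ((∫ h, c h.source ∂(fiberMeasure μ x)).toNNReal : ℝ≥0∞) :=
      (ofReal_integral_eq_lintegral_ofReal (integrable_comp_source hG hμ hc x)
        (ae_of_all _ fun h => hc.nonneg _)).symm
    rw [h1]
    exact ENNReal.mul_inv_cancel (by exact_mod_cast hne) ENNReal.coe_ne_top
  exists_isCompact C hC := by
    refine ⟨_, hc.isCompact_tsupport_inter C hC, fun x hx => ?_⟩
    have hm : Measurable fun h : TargetFiber X x => (c h.source).toNNReal :=
      (continuous_comp_source hG hc x).measurable.real_toNNReal
    rw [ae_withDensity_iff (hm.div_const _).coe_nnreal_ennreal]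
    refine ae_of_all _ fun h hh => ⟨subset_tsupport (fun g : Arr X => c g.left) ?_, hx⟩
    intro (h0 : c h.source = 0)
    simp [h0] at hh
  continuous_integral φ hφ := by
    have h1 := continuous_integral_mul_comp_source hG hμ hc φ hφ
    have h2 := continuous_integral_mul_comp_source hG hμ hc (fun _ => 1) continuous_const
    simp only [one_mul] at h2
    refine (h1.div h2 fun x => (integral_comp_source_pos hG hμ hc x).ne').congr fun x => ?_
    have hm : Measurable fun h : TargetFiber X x => (c h.source).toNNReal :=
      (continuous_comp_source hG hc x).measurable.real_toNNReal
    rw [integral_withDensity_eq_integral_smul (hm.div_const _), Pi.div_apply, ← integral_div]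
    congr 1
    ext h
    rw [NNReal.smul_def, NNReal.coe_div, Real.coe_toNNReal _ (hc.nonneg _),
      Real.coe_toNNReal _ (integral_comp_source_pos hG hμ hc x).le, smul_eq_mul]
    ring
  map_mulLeft x y g := by
    rw [← integral_comp_source_eq hG hμ g, ← hμ.map_mulLeft hG g]
    have ht := (isClosedEmbedding_mulLeft hG g).measurableEmbedding
    ext s hs
    rw [ht.map_apply, withDensity_apply _ hs, withDensity_apply _ (ht.measurable hs),
      ht.restrict_map, ht.lintegral_map]
    rfl

end

theorem IsProperGroupoid.nonempty_invariantMean [T2Space X] (hG : IsProperGroupoid X) :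
    Nonempty (InvariantMean X) := by
  obtain ⟨μ, hμ⟩ := hG.exists_haarSystem
  obtain ⟨c, hc⟩ := hG.exists_cutoff
  have := hG.t2Space
  have := hG.locallyCompactSpace
  exact ⟨cutoffMean hG.toIsTopologicalGroupoid hμ hc⟩

end Groupoid

/-! ## Convergence in Banach bundles -/

section Bundle

variable {X : Type*} [TopologicalSpace X] {E : X → Type*}

/-- The points `v p` of a bundle tend to the point `v₀` in the total space. -/
abbrev TendstoIn (E : X → Type*) [TopologicalSpace (Tot E)] {P : Type*} (l : Filter P) {x : P → X}
    (v : ∀ p, E (x p)) {x₀ : X} (v₀ : E x₀) : Prop :=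
  Tendsto (fun p => (⟨x p, v p⟩ : Tot E)) l (𝓝 ⟨x₀, v₀⟩)

/-- The arrows `g p` of a groupoid tend to the arrow `g₀`. -/
abbrev TendstoArr {X : Type*} [Groupoid X] [TopologicalSpace (Arr X)] {P : Type*} (l : Filter P)
    {x y : P → X} (g : ∀ p, x p ⟶ y p) {x₀ y₀ : X} (g₀ : x₀ ⟶ y₀) : Prop :=
  Tendsto (fun p => (⟨x p, y p, g p⟩ : Arr X)) l (𝓝 ⟨x₀, y₀, g₀⟩)

omit [TopologicalSpace X] in
theorem tendsto_pull_iff [TopologicalSpace (Tot E)] {Y : Type*} [TopologicalSpace Y] {u : Y → X}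
    {P : Type*} {l : Filter P} {f : P → Pull u E} {q : Pull u E} :
    Tendsto f l (𝓝 q) ↔ Tendsto (fun p => (f p).proj) l (𝓝 q.proj) ∧
      TendstoIn E l (fun p => vec (f p)) (vec q) := by
  rw [(inducing_pullbackTotalSpaceEmbedding Unit E u).tendsto_nhds_iff]
  exact Prod.tendsto_iff _ _

variable [∀ x, NormedAddCommGroup (E x)] [∀ x, NormedSpace ℝ (E x)] [TopologicalSpace (Tot E)]
  (hE : IsBanachBundle E)

section

variable {P : Type*} {l : Filter P} {x : P → X} {v w : ∀ p, E (x p)} {x₀ : X} {v₀ w₀ : E x₀}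

include hE

theorem IsBanachBundle.tendsto_proj (hv : TendstoIn E l v v₀) : Tendsto x l (𝓝 x₀) :=
  (hE.continuous_proj.tendsto _).comp hv

theorem IsBanachBundle.tendsto_add (hv : TendstoIn E l v v₀) (hw : TendstoIn E l w w₀) :
    TendstoIn E l (fun p => v p + w p) (v₀ + w₀) := by
  have h : Tendsto (fun p => (⟨⟨x p, v p⟩, w p⟩ : Pull (fun e : Tot E => e.proj) E)) l
      (𝓝 ⟨⟨x₀, v₀⟩, w₀⟩) := tendsto_pull_iff.2 ⟨hv, hw⟩
  exact (hE.continuous_add.tendsto _).comp h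

theorem IsBanachBundle.tendsto_smul {r : P → ℝ} {r₀ : ℝ} (hr : Tendsto r l (𝓝 r₀))
    (hv : TendstoIn E l v v₀) : TendstoIn E l (fun p => r p • v p) (r₀ • v₀) :=
  (hE.continuous_smul.tendsto (r₀, ⟨x₀, v₀⟩)).comp (hr.prodMk_nhds hv)

theorem IsBanachBundle.tendsto_sub (hv : TendstoIn E l v v₀) (hw : TendstoIn E l w w₀) :
    TendstoIn E l (fun p => v p - w p) (v₀ - w₀) := by
  simpa [sub_eq_add_neg] using
    hE.tendsto_add hv (hE.tendsto_smul (tendsto_const_nhds (x := (-1 : ℝ))) hw)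

theorem IsBanachBundle.tendsto_norm (hv : TendstoIn E l v v₀) :
    Tendsto (fun p => ‖v p‖) l (𝓝 ‖v₀‖) :=
  (hE.continuous_norm.tendsto _).comp hv

theorem IsBanachBundle.tendsto_zero (hx : Tendsto x l (𝓝 x₀))
    (hv : Tendsto (fun p => ‖v p‖) l (𝓝 0)) : TendstoIn E l v (0 : E x₀) :=
  (tendsto_comap_iff.2 (hx.prodMk_nhds hv)).mono_right (hE.comap_nhds_le x₀)

/-- Together with `tendsto_norm_sub` this reduces convergence in the total space to norm estimates
against a family whose limit is known. -/
theorem IsBanachBundle.tendsto_of_norm_sub (hv : TendstoIn E l v v₀)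
    (hw : Tendsto (fun p => ‖w p - v p‖) l (𝓝 0)) : TendstoIn E l w v₀ := by
  simpa using hE.tendsto_add hv (hE.tendsto_zero (hE.tendsto_proj hv) hw)

theorem IsBanachBundle.tendsto_norm_sub (hv : TendstoIn E l v v₀) (hw : TendstoIn E l w v₀) :
    Tendsto (fun p => ‖v p - w p‖) l (𝓝 0) := by
  simpa using hE.tendsto_norm (hE.tendsto_sub hv hw)

end

theorem IsBanachBundle.continuous_of_continuous_total (hE : IsBanachBundle E) {S : Type*}
    [TopologicalSpace S] {x : X} {f : S → E x}
    (hf : Continuous fun s => (⟨x, f s⟩ : Tot E)) : Continuous f := by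
  rw [continuous_iff_continuousAt]
  intro s
  rw [ContinuousAt, tendsto_iff_norm_sub_tendsto_zero]
  exact hE.tendsto_norm_sub (hf.tendsto s)
    (tendsto_const_nhds : Tendsto (fun _ => (⟨x, f s⟩ : Tot E)) _ _)

/-- A vector of a fiber extends to sections which converge to it, after passage to subnets. Hence
these may be used to test convergence. -/
theorem IsBanachBundle.tendsto_of_sections.{u₁, u₂, u₃} {X : Type u₁} [TopologicalSpace X]
    {E : X → Type u₂} [∀ x, NormedAddCommGroup (E x)] [∀ x, NormedSpace ℝ (E x)]
    [TopologicalSpace (Tot E)] (hE : IsBanachBundle E) {P : Type u₃} {l : Filter P}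
    {x : P → X} {x₀ : X} (hx : Tendsto x l (𝓝 x₀)) {v : ∀ p, E (x p)} {v₀ : E x₀}
    (H : ∀ (Q : Type max u₂ u₃) (q : Q → P) (m : Filter Q) (s : E x₀ → ∀ i, E (x (q i))),
      Tendsto q m l → (∀ a, TendstoIn E m (s a) a) → TendstoIn E m (fun i => v (q i)) v₀) :
    TendstoIn E l v v₀ := by
  rw [TendstoIn, tendsto_iff_ultrafilter]
  intro g hg
  -- The new index consists of `p` and a simultaneous choice of a vector over `x p` for every `a`.
  -- The filter `m` forces these choices to converge. It is proper because a neighborhood in the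
  -- product topology constrains only finitely many `a`, and for these the open projection provides
  -- suitable vectors.
  let M : (Σ p, E x₀ → E (x p)) → P × (E x₀ → Tot E) := fun i => (i.1, fun a => ⟨x i.1, i.2 a⟩)
  let m : Filter (Σ p, E x₀ → E (x p)) :=
    comap M (g ×ˢ 𝓝 (fun a => (⟨x₀, a⟩ : Tot E)))
  have hm : m.NeBot := by
    rw [comap_neBot_iff]
    intro t ht
    obtain ⟨S, hS, N, hN, hSN⟩ := mem_prod_iff.1 ht
    rw [nhds_pi, Filter.mem_pi] at hN
    obtain ⟨I, hI, N', hN', hIN⟩ := hN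
    have h1 : ∀ᶠ p in (g : Filter P), ∀ a ∈ I, x p ∈ (fun e : Tot E => e.proj) '' N' a := by
      rw [eventually_all_finite hI]
      intro a _
      exact (hx.mono_left hg).eventually (hE.isOpenMap_proj.image_mem_nhds (hN' a))
    obtain ⟨p, hpS, hp⟩ := (Filter.Eventually.and hS h1).exists
    have h2 : ∀ a : E x₀, ∃ e : E (x p), a ∈ I → (⟨x p, e⟩ : Tot E) ∈ N' a := by
      intro a
      by_cases ha : a ∈ I
      · obtain ⟨⟨y, e⟩, he, rfl⟩ := hp a ha
        exact ⟨e, fun _ => he⟩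
      · exact ⟨0, fun h => (ha h).elim⟩
    choose e he using h2
    exact ⟨⟨p, e⟩, hSN ⟨hpS, hIN fun a ha => he a ha⟩⟩
  have hMm : Tendsto M m (g ×ˢ 𝓝 (fun a => (⟨x₀, a⟩ : Tot E))) := tendsto_comap
  have hfst : Tendsto (fun i : Σ p, E x₀ → E (x p) => i.1) m g := tendsto_fst.comp hMm
  -- Since `g` is an ultrafilter, the projection of `m`, being finer, is all of `g`; so convergence
  -- along `m` descends to `g`.
  have hmap : map (fun i : Σ p, E x₀ → E (x p) => i.1) m = g :=
    Ultrafilter.unique g hfst (hm.map _)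
  have := H _ (fun i : Σ p, E x₀ → E (x p) => i.1) m (fun a i => i.2 a) (hfst.mono_right hg)
    fun a => (tendsto_pi_nhds.1 (tendsto_snd.comp hMm)) a
  rw [← hmap, tendsto_map'_iff]
  exact this

end Bundle

/-! ## Asymptotically linear families of sections -/

/-- Families of maps `s · z` into normed spaces that become linear and isometric along `l`. -/
structure IsAsymptoticallyLinear {Z : Type*} (l : Filter Z) {B : Z → Type*}
    [∀ z, NormedAddCommGroup (B z)] [∀ z, NormedSpace ℝ (B z)] {B₀ : Type*}
    [NormedAddCommGroup B₀] [NormedSpace ℝ B₀] (s : B₀ → ∀ z, B z) : Prop where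
  tendsto_add : ∀ a b, Tendsto (fun z => ‖s (a + b) z - (s a z + s b z)‖) l (𝓝 0)
  tendsto_smul : ∀ (r : ℝ) (a), Tendsto (fun z => ‖s (r • a) z - r • s a z‖) l (𝓝 0)
  tendsto_norm : ∀ a, Tendsto (fun z => ‖s a z‖) l (𝓝 ‖a‖)

theorem IsBanachBundle.isAsymptoticallyLinear {X : Type*} [TopologicalSpace X] {E : X → Type*}
    [∀ x, NormedAddCommGroup (E x)] [∀ x, NormedSpace ℝ (E x)] [TopologicalSpace (Tot E)]
    (hE : IsBanachBundle E) {Z : Type*} {l : Filter Z} {x : Z → X} {x₀ : X}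
    {s : E x₀ → ∀ z, E (x z)} (hs : ∀ a, TendstoIn E l (s a) a) :
    IsAsymptoticallyLinear l s where
  tendsto_add a b := hE.tendsto_norm_sub (hs _) (hE.tendsto_add (hs a) (hs b))
  tendsto_smul _ a := hE.tendsto_norm_sub (hs _) (hE.tendsto_smul tendsto_const_nhds (hs a))
  tendsto_norm a := hE.tendsto_norm (hs a)

theorem isAsymptoticallyLinear_const {Z : Type*} (l : Filter Z) (B : Type*)
    [NormedAddCommGroup B] [NormedSpace ℝ B] :
    IsAsymptoticallyLinear l fun (a : B) (_ : Z) => a where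
  tendsto_add a b := by simpa using tendsto_const_nhds
  tendsto_smul r a := by simpa using tendsto_const_nhds
  tendsto_norm a := tendsto_const_nhds

section

variable {Z : Type*} {l : Filter Z} {B : Z → Type*} [∀ z, NormedAddCommGroup (B z)]
  [∀ z, NormedSpace ℝ (B z)] {B₀ : Type*} [NormedAddCommGroup B₀] [NormedSpace ℝ B₀]
  {s : B₀ → ∀ z, B z} (hs : IsAsymptoticallyLinear l s)

include hs

theorem IsAsymptoticallyLinear.tendsto_smul_smul {r : Z → ℝ} {r₀ : ℝ} (hr : Tendsto r l (𝓝 r₀))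
    (a : B₀) : Tendsto (fun z => ‖s (r₀ • a) z - r z • s a z‖) l (𝓝 0) := by
  have h1 : Tendsto (fun z => ‖s (r₀ • a) z - r₀ • s a z‖ + |r₀ - r z| * ‖s a z‖) l (𝓝 0) := by
    have h2 : Tendsto (fun z => |r₀ - r z|) l (𝓝 0) := by
      simpa using ((tendsto_const_nhds (x := r₀)).sub hr).abs
    simpa using (hs.tendsto_smul r₀ a).add (h2.mul (hs.tendsto_norm a))
  refine squeeze_zero (fun z => norm_nonneg _) (fun z => ?_) h1
  calc ‖s (r₀ • a) z - r z • s a z‖ =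
      ‖(s (r₀ • a) z - r₀ • s a z) + (r₀ - r z) • s a z‖ := by rw [sub_smul]; congr 1; abel
    _ ≤ _ := (norm_add_le _ _).trans (by rw [norm_smul, Real.norm_eq_abs])

theorem IsAsymptoticallyLinear.tendsto_sum_smul {ι : Type*} (t : Finset ι) {r : ι → Z → ℝ}
    {r₀ : ι → ℝ} (hr : ∀ i, Tendsto (r i) l (𝓝 (r₀ i))) (a : ι → B₀) :
    Tendsto (fun z => ‖s (∑ i ∈ t, r₀ i • a i) z - ∑ i ∈ t, r i z • s (a i) z‖) l (𝓝 0) := by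
  classical
  induction t using Finset.induction_on with
  | empty => simpa using hs.tendsto_norm 0
  | insert j t hj ih =>
    have h1 := ((hs.tendsto_add (r₀ j • a j) (∑ i ∈ t, r₀ i • a i)).add
      (hs.tendsto_smul_smul (hr j) (a j))).add ih
    rw [add_zero, add_zero] at h1
    refine squeeze_zero (fun z => norm_nonneg _) (fun z => ?_) h1
    rw [Finset.sum_insert hj, Finset.sum_insert hj]
    refine le_trans (le_of_eq ?_) ((norm_add_le _ _).trans (add_le_add_left (norm_add_le _ _) _))
    congr 1
    abel

theorem IsAsymptoticallyLinear.tendsto_norm_sub (a b : B₀) :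
    Tendsto (fun z => ‖s a z - s b z‖) l (𝓝 ‖a - b‖) := by
  have h1 := hs.tendsto_norm (a - b)
  have h2 : Tendsto (fun z => ‖s (a - b) z - (s a z - s b z)‖) l (𝓝 0) := by
    have h3 := (hs.tendsto_add a ((-1 : ℝ) • b)).add (hs.tendsto_smul (-1) b)
    rw [add_zero] at h3
    refine squeeze_zero (fun z => norm_nonneg _) (fun z => ?_) h3
    have e : s (a - b) z - (s a z - s b z) = (s (a + (-1 : ℝ) • b) z -
      (s a z + s ((-1 : ℝ) • b) z)) + (s ((-1 : ℝ) • b) z - (-1 : ℝ) • s b z) := by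
      simp only [neg_smul, one_smul, sub_eq_add_neg]
      abel
    rw [e]
    exact norm_add_le _ _
  refine tendsto_of_tendsto_of_dist h1 (squeeze_zero (fun z => dist_nonneg) (fun z => ?_) h2)
  rw [Real.dist_eq]
  exact abs_norm_sub_norm_le _ _

end

/-! ## Continuity of integrals over the target fibers -/

namespace InvariantMean

variable {X : Type*} [Groupoid X] [TopologicalSpace X] [TopologicalSpace (Arr X)]
  (ν : InvariantMean X)

open TargetFiber

instance (x : X) : IsProbabilityMeasure (ν.measure x) := ν.isProbabilityMeasure x

variable [T2Space X] [T2Space (Arr X)] (hG : IsTopologicalGroupoid X)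

include hG

theorem integrable {x : X} {V : Type*} [NormedAddCommGroup V] {f : TargetFiber X x → V}
    (hf : Continuous f) : Integrable f (ν.measure x) := by
  obtain ⟨K, hK, hν⟩ := ν.exists_isCompact {x} isCompact_singleton
  have hK' := (isClosedEmbedding_toArr hG x).isCompact_preimage hK
  have hm : MeasurableSet (toArr ⁻¹' K : Set (TargetFiber X x)) :=
    (hK.isClosed.preimage (continuous_toArr x)).measurableSet
  have hae : ∀ᵐ h ∂(ν.measure x), h ∈ (toArr ⁻¹' K : Set (TargetFiber X x)) := hν x rfl
  obtain ⟨C, hC⟩ := hK'.exists_bound_of_continuousOn hf.continuousOn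
  refine Integrable.of_bound ?_ C (hae.mono hC)
  rw [← Measure.restrict_eq_self_of_ae_mem hae]
  exact hf.continuousOn.aestronglyMeasurable_of_isCompact hK' hm

omit [T2Space X] [T2Space (Arr X)] in
theorem integral_mulLeft {x y : X} (g : x ⟶ y) {V : Type*} [NormedAddCommGroup V]
    [NormedSpace ℝ V] (f : TargetFiber X y → V) :
    ∫ h, f (mulLeft g h) ∂(ν.measure x) = ∫ h, f h ∂(ν.measure y) := by
  rw [← ν.map_mulLeft g, (isClosedEmbedding_mulLeft hG g).measurableEmbedding.integral_map]

/-- Almost everywhere `f = ∑ φ i • f`, and `f` is within `ε` of `e i` wherever `φ i` does not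
vanish. -/
theorem norm_integral_sub_sum_le {x : X} {V : Type*} [NormedAddCommGroup V] [NormedSpace ℝ V]
    [CompleteSpace V] {f : TargetFiber X x → V} (hf : Continuous f) {K : Set (Arr X)}
    (hK : ∀ᵐ h ∂(ν.measure x), h.toArr ∈ K) {n : ℕ} {φ : Fin n → C(Arr X, ℝ)}
    (hφ : EqOn (∑ i, φ i) 1 K) (hφ0 : ∀ i g, 0 ≤ φ i g) {U : Fin n → Set (Arr X)}
    (hU : ∀ i, tsupport (φ i) ⊆ U i) {e : Fin n → V} {ε : ℝ}
    (he : ∀ i (h : TargetFiber X x), h.toArr ∈ U i → ‖f h - e i‖ ≤ ε) :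
    ‖(∫ h, f h ∂(ν.measure x)) - ∑ i, (∫ h, φ i h.toArr ∂(ν.measure x)) • e i‖ ≤ ε := by
  have hφc : ∀ i, Continuous fun h : TargetFiber X x => φ i h.toArr :=
    fun i => (φ i).continuous.comp (continuous_toArr x)
  have hi : ∀ i, Integrable (fun h : TargetFiber X x => φ i h.toArr • e i) (ν.measure x) :=
    fun i => ν.integrable hG ((hφc i).smul continuous_const)
  simp_rw [← integral_smul_const]
  rw [← integral_finsetSum _ fun i _ => hi i,
    ← integral_sub (ν.integrable hG hf) (integrable_finsetSum _ fun i _ => hi i)]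
  refine (norm_integral_le_of_norm_le_const (C := ε) (hK.mono fun h hh => ?_)).trans (by simp)
  have h1 : ∑ i, φ i h.toArr = 1 := by simpa using hφ hh
  calc ‖f h - ∑ i, φ i h.toArr • e i‖ = ‖∑ i, φ i h.toArr • (f h - e i)‖ := by
        simp_rw [smul_sub, Finset.sum_sub_distrib, ← Finset.sum_smul, h1, one_smul]
    _ ≤ ∑ i, φ i h.toArr * ε := by
        refine norm_sum_le_of_le _ fun i _ => ?_
        rw [norm_smul, Real.norm_of_nonneg (hφ0 i _)]
        by_cases h0 : φ i h.toArr = 0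
        · simp [h0]
        · exact mul_le_mul_of_nonneg_left (he i h (hU i (subset_tsupport _ h0))) (hφ0 i _)
    _ = ε := by rw [← Finset.sum_mul, h1, one_mul]

/-- Integrals of continuous families over the target fibers depend continuously on the base
point. -/
theorem tendsto_integral [LocallyCompactSpace (Arr X)] {Z : Type*} {l : Filter Z} {x : Z → X}
    {x₀ : X} (hx : Tendsto x l (𝓝 x₀)) {B : Z → Type*} [∀ z, NormedAddCommGroup (B z)]
    [∀ z, NormedSpace ℝ (B z)] [∀ z, CompleteSpace (B z)] {B₀ : Type*} [NormedAddCommGroup B₀]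
    [NormedSpace ℝ B₀] [CompleteSpace B₀] {s : B₀ → ∀ z, B z} (hs : IsAsymptoticallyLinear l s)
    {f : ∀ z, TargetFiber X (x z) → B z} {f₀ : TargetFiber X x₀ → B₀}
    (hf : ∀ᶠ z in l, Continuous (f z)) (hf₀ : Continuous f₀)
    (hff : ∀ h₀, Tendsto (fun p : Σ z, TargetFiber X (x z) => ‖f p.1 p.2 - s (f₀ h₀) p.1‖)
      (comap (fun p => (p.1, p.2.toArr)) (l ×ˢ 𝓝 h₀.toArr)) (𝓝 0)) :
    Tendsto (fun z => ‖(∫ h, f z h ∂(ν.measure (x z))) - s (∫ h, f₀ h ∂(ν.measure x₀)) z‖) l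
      (𝓝 0) := by
  have := hG.locallyCompactSpace_base
  -- One `ε` comes from replacing the integral over the fiber at `x z` by a finite sum, one from
  -- moving `s` through that sum. The term `2 * ε` bounds `s` of the sum over `x₀` minus `s` of the
  -- integral: its norm converges to a limit at most `ε`.
  suffices H : ∀ ε > 0, ∀ᶠ z in l,
      ‖(∫ h, f z h ∂(ν.measure (x z))) - s (∫ h, f₀ h ∂(ν.measure x₀)) z‖ ≤ ε + 2 * ε + ε by
    rw [NormedAddGroup.tendsto_nhds_zero]
    intro ε hε
    filter_upwards [H (ε / 5) (by positivity)] with z hz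
    rw [norm_norm]
    linarith
  intro ε hε
  obtain ⟨C, hC, hCx⟩ := exists_compact_mem_nhds x₀
  obtain ⟨K, hK, hν⟩ := ν.exists_isCompact C hC
  have hloc : ∀ k : Arr X, ∃ U : Set (Arr X), ∃ e : B₀, IsOpen U ∧ k ∈ U ∧
      (∀ᶠ z in l, ∀ h : TargetFiber X (x z), h.toArr ∈ U → ‖f z h - s e z‖ ≤ ε) ∧
      ∀ h : TargetFiber X x₀, h.toArr ∈ U → ‖f₀ h - e‖ ≤ ε := by
    intro k
    by_cases hk : k.right = x₀
    · obtain ⟨h₀, rfl⟩ : k ∈ range (toArr : TargetFiber X x₀ → Arr X) := by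
        rwa [range_toArr]
      have h1 := (hff h₀).eventually (gt_mem_nhds hε)
      rw [eventually_comap] at h1
      obtain ⟨S, hS, N, hN, hSN⟩ := mem_prod_iff.1 h1
      have h2 : {h : TargetFiber X x₀ | ‖f₀ h - f₀ h₀‖ < ε} ∈ 𝓝 h₀ := by
        have h3 : Continuous fun h => ‖f₀ h - f₀ h₀‖ := (hf₀.sub continuous_const).norm
        exact (isOpen_lt h3 continuous_const).mem_nhds (by simpa using hε)
      rw [(isInducing_toArr x₀).nhds_eq_comap] at h2
      obtain ⟨N', hN', hN2⟩ := h2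
      obtain ⟨U, hUN, hU, hkU⟩ := mem_nhds_iff.1 (inter_mem hN hN')
      refine ⟨U, f₀ h₀, hU, hkU, ?_, fun h hh => le_of_lt (hN2 (hUN hh).2)⟩
      filter_upwards [hS] with z hz h hh
      exact le_of_lt (hSN (mk_mem_prod hz (hUN hh).1) ⟨z, h⟩ rfl)
    -- Away from the fiber over `x₀` a small neighborhood of `k` misses that fiber and eventually
    -- the fibers over `x z`, so the vector `0` is an arbitrary choice.
    · obtain ⟨U₁, U₂, hU₁, hU₂, hk1, hx2, hd⟩ := t2_separation hk
      refine ⟨(fun g : Arr X => g.right) ⁻¹' U₁, 0, hU₁.preimage hG.continuous_target, hk1, ?_, ?_⟩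
      · filter_upwards [hx.eventually (hU₂.mem_nhds hx2)] with z hz h hh
        exact (disjoint_left.1 hd hh hz).elim
      · exact fun h hh => (disjoint_left.1 hd hh hx2).elim
  choose U e hU hkU hUf hUf₀ using hloc
  obtain ⟨t, ht⟩ := hK.elim_finite_subcover U hU fun k _ => mem_iUnion.2 ⟨k, hkU k⟩
  let κ : Fin t.card → Arr X := fun i => t.equivFin.symm i
  have hKU : K ⊆ ⋃ i, U (κ i) := by
    intro k hk
    obtain ⟨k', hk', hkk⟩ := mem_iUnion₂.1 (ht hk)
    exact mem_iUnion.2 ⟨t.equivFin ⟨k', hk'⟩, by simpa [κ] using hkk⟩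
  obtain ⟨φ, hφU, hφ1, hφI, -⟩ := exists_continuous_sum_one_of_isOpen_isCompact
    (fun i => hU (κ i)) hK hKU
  have hφ0 : ∀ i g, 0 ≤ φ i g := fun i g => (hφI i g).1
  have hr : ∀ i, Tendsto (fun z => ∫ h, φ i h.toArr ∂(ν.measure (x z))) l
      (𝓝 (∫ h, φ i h.toArr ∂(ν.measure x₀))) := fun i =>
    ((ν.continuous_integral (φ i) (φ i).continuous).tendsto x₀).comp hx
  have hsum := hs.tendsto_sum_smul Finset.univ hr fun i => e (κ i)
  have h0 := ν.norm_integral_sub_sum_le hG hf₀ (hν x₀ (mem_of_mem_nhds hCx)) hφ1 hφ0 hφU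
    fun i => hUf₀ (κ i)
  have hlim := hs.tendsto_norm_sub
    (∑ i, (∫ h, φ i h.toArr ∂(ν.measure x₀)) • e (κ i)) (∫ h, f₀ h ∂(ν.measure x₀))
  rw [norm_sub_rev] at h0
  filter_upwards [hf, hx.eventually hCx, eventually_all.2 fun i => hUf (κ i),
    hsum.eventually (gt_mem_nhds hε), hlim.eventually (gt_mem_nhds (by linarith : _ < 2 * ε))]
    with z hfz hCz hUz hsz hlz
  have h1 := ν.norm_integral_sub_sum_le hG hfz (hν _ hCz) hφ1 hφ0 hφU hUz
  have h2 := (norm_sub_le_norm_sub_add_norm_sub (∫ h, f z h ∂(ν.measure (x z)))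
    (∑ i, (∫ h, φ i h.toArr ∂(ν.measure (x z))) • s (e (κ i)) z)
    (s (∫ h, f₀ h ∂(ν.measure x₀)) z))
  have h3 := (norm_sub_le_norm_sub_add_norm_sub
    (∑ i, (∫ h, φ i h.toArr ∂(ν.measure (x z))) • s (e (κ i)) z)
    (s (∑ i, (∫ h, φ i h.toArr ∂(ν.measure x₀)) • e (κ i)) z)
    (s (∫ h, f₀ h ∂(ν.measure x₀)) z))
  rw [norm_sub_rev] at hsz
  linarith

end InvariantMean

/-! ## Operators close to the identity -/

/-- Neumann series. The constant comes from `Q = id + Q (id - P)`, which gives `‖Q‖ ≤ 1 + ‖Q‖ / 4`.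
-/
theorem exists_inverse_of_norm_id_sub_le {V : Type*} [NormedAddCommGroup V] [NormedSpace ℝ V]
    [CompleteSpace V] (P : V →L[ℝ] V) (hP : ‖ContinuousLinearMap.id ℝ V - P‖ ≤ 1 / 4) :
    ∃ Q : V →L[ℝ] V, (∀ v, P (Q v) = v) ∧ (∀ v, Q (P v) = v) ∧ ‖Q‖ ≤ 4 / 3 := by
  have hu : IsUnit P := by
    have := isUnit_one_sub_of_norm_lt_one (x := ContinuousLinearMap.id ℝ V - P) (by linarith)
    rwa [show (1 : V →L[ℝ] V) - (ContinuousLinearMap.id ℝ V - P) = P from sub_sub_cancel _ _]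
      at this
  obtain ⟨u, rfl⟩ := hu
  have h1 : ∀ v, (u : V →L[ℝ] V) ((↑u⁻¹ : V →L[ℝ] V) v) = v := fun v =>
    congr($(u.mul_inv) v)
  have h2 : ∀ v, (↑u⁻¹ : V →L[ℝ] V) ((u : V →L[ℝ] V) v) = v := fun v =>
    congr($(u.inv_mul) v)
  refine ⟨↑u⁻¹, h1, h2, ?_⟩
  have h3 : (↑u⁻¹ : V →L[ℝ] V) = ContinuousLinearMap.id ℝ V +
      (↑u⁻¹ : V →L[ℝ] V).comp (ContinuousLinearMap.id ℝ V - (u : V →L[ℝ] V)) := by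
    ext v
    simp [h2]
  have h4 := (congrArg norm h3).le.trans (norm_add_le _ _)
  have h5 := ContinuousLinearMap.opNorm_comp_le (↑u⁻¹ : V →L[ℝ] V)
    (ContinuousLinearMap.id ℝ V - (u : V →L[ℝ] V))
  have h6 := ContinuousLinearMap.norm_id_le (𝕜 := ℝ) (E := V)
  nlinarith [norm_nonneg (↑u⁻¹ : V →L[ℝ] V)]

theorem enorm_smul_clm_le {R V W : Type*} [NormedRing R] [NormedAlgebra ℝ R]
    [NormedAddCommGroup V] [NormedSpace ℝ V] [NormedAddCommGroup W] [NormedSpace ℝ W]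
    [Module R W] [IsBoundedSMul R W] [IsScalarTower ℝ R W] (a : R) (f : V →L[ℝ] W) :
    ‖a • f‖ₑ ≤ ‖a‖ₑ * ‖f‖ₑ := by
  have h : ‖a • f‖ ≤ ‖a‖ * ‖f‖ := by
    refine ContinuousLinearMap.opNorm_le_bound _ (by positivity) fun v => ?_
    rw [smul_apply, mul_assoc]
    exact (norm_smul_le _ _).trans (by gcongr; exact f.le_opNorm v)
  rw [← ofReal_norm, ← ofReal_norm, ← ofReal_norm,
    ← ENNReal.ofReal_mul (norm_nonneg _)]
  exact ENNReal.ofReal_le_ofReal h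

theorem enorm_comp_le {V W U : Type*} [NormedAddCommGroup V] [NormedSpace ℝ V]
    [NormedAddCommGroup W] [NormedSpace ℝ W] [NormedAddCommGroup U] [NormedSpace ℝ U]
    (f : W →L[ℝ] U) (g : V →L[ℝ] W) : ‖f.comp g‖ₑ ≤ ‖f‖ₑ * ‖g‖ₑ := by
  rw [← ofReal_norm, ← ofReal_norm, ← ofReal_norm,
    ← ENNReal.ofReal_mul (norm_nonneg _)]
  exact ENNReal.ofReal_le_ofReal (f.opNorm_comp_le g)

/-! ## Continuity of the operations -/

section

variable {X : Type*} [TopologicalSpace X] {A : X → Type*}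
  [∀ x, NormedRing (A x)] [∀ x, NormOneClass (A x)] [∀ x, NormedAlgebra ℝ (A x)]
  [TopologicalSpace (Tot A)] (hA : IsBanachAlgebraBundle A)
  {E : X → Type*} [∀ x, NormedAddCommGroup (E x)] [∀ x, NormedSpace ℝ (E x)]
  [∀ x, Module (A x) (E x)] [∀ x, IsBoundedSMul (A x) (E x)]
  [∀ x, IsScalarTower ℝ (A x) (E x)] [TopologicalSpace (Tot E)]
  (hE : IsBanachModuleBundle A E)
  {P : Type*} {l : Filter P} {x : P → X} {x₀ : X}

include hA in
theorem IsBanachAlgebraBundle.tendsto_mul {a b : ∀ p, A (x p)} {a₀ b₀ : A x₀}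
    (ha : TendstoIn A l a a₀) (hb : TendstoIn A l b b₀) :
    TendstoIn A l (fun p => a p * b p) (a₀ * b₀) := by
  have h : Tendsto (fun p => (⟨⟨x p, a p⟩, b p⟩ : Pull (fun e : Tot A => e.proj) A)) l
      (𝓝 ⟨⟨x₀, a₀⟩, b₀⟩) := tendsto_pull_iff.2 ⟨ha, hb⟩
  exact (hA.continuous_mul.tendsto _).comp h

-- Let `s` tend to `u₀⁻¹`. Then `1 - u s` tends to zero, and `u⁻¹ - s = u⁻¹ (1 - u s)`. As soon as
-- `‖1 - u s‖ < 1 / 2`, this identity also bounds `‖u⁻¹‖` by `2 ‖s‖`, so the difference tends to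
-- zero.
include hA in
theorem IsBanachAlgebraBundle.tendsto_units_inv {u : ∀ p, (A (x p))ˣ} {u₀ : (A x₀)ˣ}
    (hu : TendstoIn A l (fun p => (u p : A (x p))) (u₀ : A x₀)) :
    TendstoIn A l (fun p => (↑(u p)⁻¹ : A (x p))) (↑u₀⁻¹ : A x₀) := by
  have hA' := hA.toIsBanachBundle
  have hx := hA'.tendsto_proj hu
  refine hA'.tendsto_of_sections hx fun Q q m s hq hs => ?_
  have hone : TendstoIn A m (fun i => (1 : A (x (q i)))) (1 : A x₀) :=
    (hA.continuous_one.tendsto x₀).comp (hx.comp hq)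
  have huq : TendstoIn A m (fun i => (u (q i) : A (x (q i)))) (u₀ : A x₀) := hu.comp hq
  have hd : Tendsto (fun i => ‖1 - u (q i) * s ↑u₀⁻¹ i‖) m (𝓝 0) := by
    have := hA.tendsto_mul huq (hs ↑u₀⁻¹)
    rw [Units.mul_inv] at this
    exact hA'.tendsto_norm_sub hone this
  refine hA'.tendsto_of_norm_sub (hs ↑u₀⁻¹) ?_
  have hlim : Tendsto (fun i => 2 * ‖s ↑u₀⁻¹ i‖ * ‖1 - u (q i) * s ↑u₀⁻¹ i‖) m (𝓝 0) := by
    simpa using ((hA'.tendsto_norm (hs ↑u₀⁻¹)).const_mul 2).mul hd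
  refine squeeze_zero' (Eventually.of_forall fun i => norm_nonneg _) ?_ hlim
  filter_upwards [hd.eventually (gt_mem_nhds (by norm_num : (0 : ℝ) < 1 / 2))] with i hi
  have h1 : (↑(u (q i))⁻¹ : A (x (q i))) - s ↑u₀⁻¹ i =
      ↑(u (q i))⁻¹ * (1 - u (q i) * s ↑u₀⁻¹ i) := by
    rw [mul_sub, ← mul_assoc, Units.inv_mul, one_mul, mul_one]
  have h2 : ‖(↑(u (q i))⁻¹ : A (x (q i))) - s ↑u₀⁻¹ i‖ ≤
      ‖(↑(u (q i))⁻¹ : A (x (q i)))‖ * ‖1 - u (q i) * s ↑u₀⁻¹ i‖ := by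
    rw [h1]
    exact norm_mul_le _ _
  have h3 : ‖(↑(u (q i))⁻¹ : A (x (q i)))‖ ≤ 2 * ‖s ↑u₀⁻¹ i‖ := by
    have := norm_le_norm_add_norm_sub' (↑(u (q i))⁻¹ : A (x (q i))) (s ↑u₀⁻¹ i)
    nlinarith [norm_nonneg (↑(u (q i))⁻¹ : A (x (q i)))]
  exact h2.trans (mul_le_mul_of_nonneg_right h3 (norm_nonneg _))

include hE in
theorem IsBanachModuleBundle.tendsto_smul' {a : ∀ p, A (x p)} {a₀ : A x₀} {e : ∀ p, E (x p)}
    {e₀ : E x₀} (ha : TendstoIn A l a a₀) (he : TendstoIn E l e e₀) :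
    TendstoIn E l (fun p => a p • e p) (a₀ • e₀) := by
  have h : Tendsto (fun p => (⟨⟨x p, a p⟩, e p⟩ : Pull (fun e : Tot A => e.proj) E)) l
      (𝓝 ⟨⟨x₀, a₀⟩, e₀⟩) := tendsto_pull_iff.2 ⟨ha, he⟩
  exact (hE.continuous_smul'.tendsto _).comp h

end

section

variable {X : Type*} [Groupoid X] [TopologicalSpace (Arr X)]
  {E : X → Type*} [∀ x, NormedAddCommGroup (E x)] [∀ x, NormedSpace ℝ (E x)]
  [TopologicalSpace (Tot E)] (T : Pseudorep E)
  {P : Type*} {l : Filter P} {x y : P → X} {x₀ y₀ : X} {g : ∀ p, x p ⟶ y p} {g₀ : x₀ ⟶ y₀}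

theorem Pseudorep.tendsto (hg : TendstoArr l g g₀) {e : ∀ p, E (x p)} {e₀ : E x₀}
    (he : TendstoIn E l e e₀) : TendstoIn E l (fun p => T (g p) (e p)) (T g₀ e₀) := by
  have h : Tendsto (fun p => (⟨⟨x p, y p, g p⟩, e p⟩ : Pull (fun g : Arr X => g.left) E)) l
      (𝓝 ⟨⟨x₀, y₀, g₀⟩, e₀⟩) := tendsto_pull_iff.2 ⟨hg, he⟩
  exact (tendsto_pull_iff.1 ((T.continuous_toFun.tendsto _).comp h)).2

/-- Continuous families of operators are locally bounded. -/
theorem Pseudorep.exists_norm_le [TopologicalSpace X] (hG : IsTopologicalGroupoid X)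
    (hE : IsBanachBundle E) (hg : TendstoArr l g g₀) : ∃ C : ℝ, ∀ᶠ p in l, ‖T (g p)‖ ≤ C := by
  -- Along this filter the arrow tends to `g₀` and the norm of the vector to zero, so the vector
  -- tends to zero in the total space. Continuity of `T` then gives one radius `ε` that works for
  -- all arrows near `g₀`.
  let m : Filter (Pull (fun g : Arr X => g.left) E) :=
    comap (fun q => (q.proj, ‖vec q‖)) (𝓝 ((⟨x₀, y₀, g₀⟩ : Arr X), (0 : ℝ)))
  have hm : Tendsto (fun q : Pull (fun g : Arr X => g.left) E => (q.proj, ‖vec q‖)) m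
      (𝓝 ((⟨x₀, y₀, g₀⟩ : Arr X), (0 : ℝ))) := tendsto_comap
  rw [nhds_prod_eq] at hm
  have hm1 : TendstoArr m (fun q : Pull (fun g : Arr X => g.left) E => q.proj.hom) g₀ :=
    tendsto_fst.comp hm
  have hm2 : TendstoIn E m (fun q : Pull (fun g : Arr X => g.left) E => vec q) (0 : E x₀) :=
    hE.tendsto_zero (hG.tendsto_source hm1) (tendsto_snd.comp hm)
  have hT := hE.tendsto_norm (T.tendsto hm1 hm2)
  rw [map_zero, norm_zero] at hT
  have hT1 := hT.eventually (gt_mem_nhds one_pos)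
  rw [eventually_comap, nhds_prod_eq] at hT1
  obtain ⟨S, hS, N, hN, hSN⟩ := mem_prod_iff.1 hT1
  obtain ⟨ε, hε, hεN⟩ := Metric.mem_nhds_iff.1 hN
  refine ⟨1 / (ε / 2), ?_⟩
  filter_upwards [hg hS] with p hp
  -- It is enough to test vectors with `ε / 2 ≤ ‖e‖ < ε`, on which `‖T(g) e‖ < 1`.
  refine ContinuousLinearMap.opNorm_le_of_shell (c := (2 : ℝ)) hε (by positivity) (by norm_num)
    fun e he he' => ?_
  have hN' : ‖e‖ ∈ N := hεN (by simpa using he')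
  have h1 : ‖T (g p) e‖ < 1 := hSN (mk_mem_prod hp hN') ⟨⟨x p, y p, g p⟩, e⟩ rfl
  rw [Real.norm_of_nonneg zero_le_two] at he
  refine h1.le.trans ?_
  rwa [div_mul_eq_mul_div, one_mul, one_le_div (by positivity)]

end

/-! ## Invertibility and estimates -/

section

variable {X : Type*} [Groupoid X] [TopologicalSpace (Arr X)] {A : X → Type*}
  [∀ x, NormedRing (A x)] [∀ x, NormedAlgebra ℝ (A x)] [TopologicalSpace (Tot A)]
  {α : AlgebraAction A} (σ : Multiplier α)

theorem Multiplier.tendsto {P : Type*} {l : Filter P} {x y z : P → X} {g : ∀ p, y p ⟶ z p}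
    {h : ∀ p, x p ⟶ y p} {x₀ y₀ z₀ : X} {g₀ : y₀ ⟶ z₀} {h₀ : x₀ ⟶ y₀}
    (hg : TendstoArr l g g₀) (hh : TendstoArr l h h₀) :
    TendstoIn A l (fun p => (σ (g p) (h p) : A (z p))) (σ g₀ h₀ : A z₀) := by
  have hp : Tendsto (fun p => (⟨g p, h p⟩ : CompPair X)) l (𝓝 ⟨g₀, h₀⟩) := by
    have : IsInducing (CompPair.toProd : CompPair X → _) := ⟨rfl⟩
    rw [this.tendsto_nhds_iff]
    exact hg.prodMk_nhds hh
  exact (σ.continuous_toFun.tendsto _).comp hp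

/-- This is the cocycle identity for `(g, g⁻¹, g)`, in which normalization removes two of the four
factors. As `G` acts isometrically, it makes the weight `ℓ` symmetric under inversion. -/
theorem Multiplier.inv_apply_inv {x y : X} (g : x ⟶ y) :
    (↑(σ g (Groupoid.inv g))⁻¹ : A y) = α.act g (↑(σ (Groupoid.inv g) g)⁻¹ : A x) := by
  have h : (σ g (Groupoid.inv g) : A y) = α.act g (σ (Groupoid.inv g) g : A x) := by
    have := σ.cocycle g (Groupoid.inv g) g
    rw [Groupoid.inv_comp, Groupoid.comp_inv, σ.normal_left, σ.normal_right] at this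
    simpa using this
  refine Units.inv_eq_of_mul_eq_one_right ?_
  rw [h, ← map_mul, Units.mul_inv, map_one]

theorem Multiplier.ell_inv {x y : X} (g : x ⟶ y) : σ.ell (Groupoid.inv g) = σ.ell g := by
  have e : Groupoid.inv (Groupoid.inv g) = g := by simp
  rw [Multiplier.ell, Multiplier.ell, σ.inv_apply_inv g, e, ← ofReal_norm, ← ofReal_norm,
    α.norm_act]

variable {E : X → Type*} [∀ x, NormedAddCommGroup (E x)] [∀ x, NormedSpace ℝ (E x)]
  [∀ x, Module (A x) (E x)] [∀ x, IsBoundedSMul (A x) (E x)]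
  [∀ x, IsScalarTower ℝ (A x) (E x)] [TopologicalSpace (Tot E)] (T : Pseudorep E)

theorem Pseudorep.defect_congr {x y : X} (g : x ⟶ y) : T.defect σ x = T.defect σ y := by
  have h : ∀ z, Nonempty (x ⟶ z) ↔ Nonempty (y ⟶ z) := fun z =>
    ⟨fun ⟨k⟩ => ⟨Groupoid.inv g ≫ k⟩, fun ⟨k⟩ => ⟨g ≫ k⟩⟩
  simp only [Pseudorep.defect, h]

omit [∀ x, Module (A x) (E x)] [∀ x, IsBoundedSMul (A x) (E x)]
  [∀ x, IsScalarTower ℝ (A x) (E x)] in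
theorem Pseudorep.bound_congr {x y : X} (g : x ⟶ y) : T.bound σ x = T.bound σ y := by
  have h : ∀ z, Nonempty (x ⟶ z) ↔ Nonempty (y ⟶ z) := fun z =>
    ⟨fun ⟨k⟩ => ⟨Groupoid.inv g ≫ k⟩, fun ⟨k⟩ => ⟨g ≫ k⟩⟩
  simp only [Pseudorep.bound, h]

omit [∀ x, Module (A x) (E x)] [∀ x, IsBoundedSMul (A x) (E x)]
  [∀ x, IsScalarTower ℝ (A x) (E x)] in
theorem Pseudorep.ell_mul_enorm_le_bound {y z : X} (g : y ⟶ z) :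
    σ.ell g * ‖T g‖ₑ ≤ T.bound σ z :=
  le_iSup₂_of_le z ⟨𝟙 z⟩ (le_iSup₂_of_le y g le_rfl)

/-- The two terms are kept together since the perturbation in `exists_inverse_comp_inv` consists of
both, and only their sum is known to be at most `1 / 4`. -/
theorem Pseudorep.add_le_defect {w y z : X} (g : y ⟶ z) (h : w ⟶ y) :
    ‖ContinuousLinearMap.id ℝ (E z) - T (𝟙 z)‖ₑ +
      σ.ell g * ‖(σ g h : A z) • T (h ≫ g) - (T g).comp (T h)‖ₑ ≤ T.defect σ z :=
  add_le_add (le_iSup₂_of_le z ⟨𝟙 z⟩ le_rfl)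
    (le_iSup₂_of_le z ⟨𝟙 z⟩ (le_iSup₂_of_le y g (le_iSup₂_of_le w h le_rfl)))

theorem Pseudorep.ell_mul_le_defect {w y z : X} (g : y ⟶ z) (h : w ⟶ y) :
    σ.ell g * ‖(σ g h : A z) • T (h ≫ g) - (T g).comp (T h)‖ₑ ≤ T.defect σ z :=
  le_add_self.trans (T.add_le_defect σ g h)

theorem Pseudorep.defect_le_of_forall {x : X} {C : ℝ≥0∞} (h₁ : ∀ y, T (𝟙 y) = .id ℝ (E y))
    (h₂ : ∀ ⦃w y z : X⦄ (_ : x ⟶ z) (g : y ⟶ z) (h : w ⟶ y),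
      σ.ell g * ‖(σ g h : A z) • T (h ≫ g) - (T g).comp (T h)‖ₑ ≤ C) : T.defect σ x ≤ C := by
  have h0 : ∀ y, ‖ContinuousLinearMap.id ℝ (E y) - T (𝟙 y)‖ₑ = 0 := fun y => by
    rw [h₁, sub_self]
    exact enorm_zero (E := E y →L[ℝ] E y)
  simp only [Pseudorep.defect, h0, ENNReal.iSup_zero, zero_add]
  exact iSup₂_le fun z ⟨k⟩ => iSup₂_le fun y g => iSup₂_le fun w h => h₂ k g h

omit [∀ x, Module (A x) (E x)] [∀ x, IsBoundedSMul (A x) (E x)]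
  [∀ x, IsScalarTower ℝ (A x) (E x)] in
theorem Pseudorep.bound_le_of_forall {x : X} {C : ℝ≥0∞}
    (h : ∀ ⦃y z : X⦄ (_ : x ⟶ z) (g : y ⟶ z), σ.ell g * ‖T g‖ₑ ≤ C) : T.bound σ x ≤ C :=
  iSup₂_le fun _ ⟨k⟩ => iSup₂_le fun _ g => h k g

variable {σ T} (hE : ∀ x, CompleteSpace (E x)) (hT : ∀ x, T.defect σ x ≤ 1 / 4)

include hE hT

/-- With `u = σ(g, g⁻¹)`, the difference `id - u⁻¹ T(g) T(g⁻¹)` equals `(id - T(1)) + u⁻¹ (u T(1) -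
T(g) T(g⁻¹))`. Since `ℓ(σ, g)` dominates `‖u⁻¹‖`, the weighted defect bounds this by `1 / 4`. -/
theorem Pseudorep.exists_inverse_comp_inv {x y : X} (g : x ⟶ y) : ∃ Q : E y →L[ℝ] E y,
    (∀ v, (↑(σ g (Groupoid.inv g))⁻¹ : A y) • T g (T (Groupoid.inv g) (Q v)) = v) ∧
    (∀ v, Q ((↑(σ g (Groupoid.inv g))⁻¹ : A y) • T g (T (Groupoid.inv g) v)) = v) ∧
    ‖Q‖ ≤ 4 / 3 := by
  set u := σ g (Groupoid.inv g)
  have := hE y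
  refine exists_inverse_of_norm_id_sub_le
    ((↑u⁻¹ : A y) • (T g).comp (T (Groupoid.inv g))) ?_
  have h1 : ContinuousLinearMap.id ℝ (E y) - (↑u⁻¹ : A y) • (T g).comp (T (Groupoid.inv g)) =
      (ContinuousLinearMap.id ℝ (E y) - T (𝟙 y)) + (↑u⁻¹ : A y) •
        ((u : A y) • T (Groupoid.inv g ≫ g) - (T g).comp (T (Groupoid.inv g))) := by
    rw [smul_sub, smul_smul, Units.inv_mul, one_smul, Groupoid.inv_comp]
    abel
  have h2 : ‖ContinuousLinearMap.id ℝ (E y) -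
      (↑u⁻¹ : A y) • (T g).comp (T (Groupoid.inv g))‖ₑ ≤ 1 / 4 := by
    rw [h1]
    refine le_trans ?_ ((T.add_le_defect σ g (Groupoid.inv g)).trans (hT y))
    refine (enorm_add_le (E := E y →L[ℝ] E y) _ _).trans (add_le_add le_rfl ?_)
    exact (enorm_smul_clm_le _ _).trans (mul_le_mul_left (le_max_right _ _) _)
  rw [← toReal_enorm]
  refine (ENNReal.toReal_mono (by simp) h2).trans ?_
  simp

theorem Pseudorep.exists_rightInverse {x y : X} (g : x ⟶ y) : ∃ S : E y →L[ℝ] E x,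
    (∀ v, T g (S v) = v) ∧
    ‖S‖ ≤ 4 / 3 * (‖T (Groupoid.inv g)‖ * ‖(↑(σ g (Groupoid.inv g))⁻¹ : A y)‖) := by
  obtain ⟨Q, hQ, -, hQn⟩ := Pseudorep.exists_inverse_comp_inv hE hT g
  set u := σ g (Groupoid.inv g)
  -- No `A`-linearity of `T` is assumed here, so `u⁻¹` has to be applied before `Q` and is cancelled
  -- by `u` only at the end.
  let S : E y →L[ℝ] E x :=
    (T (Groupoid.inv g)).comp (Q.comp ((↑u⁻¹ : A y) • ContinuousLinearMap.id ℝ (E y)))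
  refine ⟨S, fun v => ?_, ?_⟩
  · have h := congrArg (fun v => (u : A y) • v) (hQ ((↑u⁻¹ : A y) • v))
    simp only [smul_smul, Units.mul_inv, one_smul] at h
    exact h
  · refine ContinuousLinearMap.opNorm_le_bound _ (by positivity) fun v => ?_
    calc ‖S v‖ ≤ ‖T (Groupoid.inv g)‖ * (‖Q‖ * (‖(↑u⁻¹ : A y)‖ * ‖v‖)) := by
          refine ((T (Groupoid.inv g)).le_opNorm _).trans
            (mul_le_mul_of_nonneg_left ?_ (norm_nonneg _))
          refine (Q.le_opNorm _).trans (mul_le_mul_of_nonneg_left ?_ (norm_nonneg _))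
          exact norm_smul_le _ _
      _ ≤ ‖T (Groupoid.inv g)‖ * (4 / 3 * (‖(↑u⁻¹ : A y)‖ * ‖v‖)) := by gcongr
      _ = _ := by ring

/-- For the arrow `g⁻¹` the operator `Q` yields a left inverse of `T(g⁻¹⁻¹) = T(g)` up to the outer
factors: `Q` recovers `v` from `u⁻¹ T(g⁻¹) T(g) v`. -/
theorem Pseudorep.injective {x y : X} (g : x ⟶ y) : Function.Injective (T g) := by
  obtain ⟨Q, -, hQ, -⟩ := Pseudorep.exists_inverse_comp_inv hE hT (Groupoid.inv g)
  intro v w h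
  have e : Groupoid.inv (Groupoid.inv g) = g := by simp
  rw [e] at hQ
  rw [← hQ v, ← hQ w, h]

theorem Pseudorep.isInvertible {x y : X} (g : x ⟶ y) : (T g).IsInvertible := by
  obtain ⟨S, hS, -⟩ := Pseudorep.exists_rightInverse hE hT g
  refine ContinuousLinearMap.IsInvertible.of_inverse (g := S) (by ext v; exact hS v) ?_
  ext v
  exact Pseudorep.injective hE hT g (hS _)

theorem Pseudorep.norm_inverse_le {x y : X} (g : x ⟶ y) : ‖(T g).inverse‖ ≤
    4 / 3 * (‖T (Groupoid.inv g)‖ * ‖(↑(σ g (Groupoid.inv g))⁻¹ : A y)‖) := by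
  obtain ⟨S, hS, hSn⟩ := Pseudorep.exists_rightInverse hE hT g
  have : (T g).inverse = S := by
    ext v
    refine Pseudorep.injective hE hT g ?_
    rw [hS, (Pseudorep.isInvertible hE hT g).self_apply_inverse]
  rwa [this]

/-- The factor `‖σ(g, g⁻¹)⁻¹‖` is at most `ℓ(σ, g) = ℓ(σ, g⁻¹)`; so its product with `‖T(g⁻¹)‖` is
bounded by a term of the supremum defining `b`, which is constant on orbits. -/
theorem Pseudorep.enorm_inverse_le {x y : X} (g : x ⟶ y) :
    ‖(T g).inverse‖ₑ ≤ 4 / 3 * T.bound σ y := by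
  have h1 : ‖(T g).inverse‖ₑ ≤ 4 / 3 * (‖(↑(σ g (Groupoid.inv g))⁻¹ : A y)‖ₑ *
      ‖T (Groupoid.inv g)‖ₑ) := by
    have h := ENNReal.ofReal_le_ofReal (Pseudorep.norm_inverse_le hE hT g)
    rwa [ENNReal.ofReal_mul (by positivity), ENNReal.ofReal_mul (by positivity), ofReal_norm,
      ofReal_norm, ofReal_norm, ENNReal.ofReal_div_of_pos (by norm_num),
      mul_comm ‖T (Groupoid.inv g)‖ₑ, ENNReal.ofReal_ofNat, ENNReal.ofReal_ofNat] at h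
  refine h1.trans (mul_le_mul_right ?_ _)
  rw [T.bound_congr σ (Groupoid.inv g)]
  refine le_trans ?_ (T.ell_mul_enorm_le_bound σ (Groupoid.inv g))
  rw [σ.ell_inv]
  exact mul_le_mul_left (le_max_right _ _) _

end

/-! ### Continuity of the inverse operators -/

section

variable {X : Type*} [Groupoid X] [TopologicalSpace X] [TopologicalSpace (Arr X)]
  (hG : IsTopologicalGroupoid X) {A : X → Type*}
  [∀ x, NormedRing (A x)] [∀ x, NormOneClass (A x)] [∀ x, NormedAlgebra ℝ (A x)]
  [TopologicalSpace (Tot A)] (hA : IsBanachAlgebraBundle A)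
  {α : AlgebraAction A} {σ : Multiplier α}
  {E : X → Type*} [∀ x, NormedAddCommGroup (E x)] [∀ x, NormedSpace ℝ (E x)]
  [∀ x, Module (A x) (E x)] [∀ x, IsBoundedSMul (A x) (E x)]
  [∀ x, IsScalarTower ℝ (A x) (E x)] [TopologicalSpace (Tot E)]
  (hE : IsBanachModuleBundle A E) {T : Pseudorep E} (hT : ∀ x, T.defect σ x ≤ 1 / 4)
  {P : Type*} {l : Filter P} {x y : P → X} {x₀ y₀ : X} {g : ∀ p, x p ⟶ y p} {g₀ : x₀ ⟶ y₀}

include hG hA hE hT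

theorem Pseudorep.exists_norm_inverse_le (hg : TendstoArr l g g₀) :
    ∃ C : ℝ, ∀ᶠ p in l, ‖(T (g p)).inverse‖ ≤ C := by
  obtain ⟨C, hC⟩ := T.exists_norm_le hG hE.toIsBanachBundle (hG.tendsto_inv hg)
  have h := hA.toIsBanachBundle.tendsto_norm
    (hA.tendsto_units_inv (σ.tendsto hg (hG.tendsto_inv hg)))
  set D := ‖(↑(σ g₀ (Groupoid.inv g₀))⁻¹ : A y₀)‖
  refine ⟨4 / 3 * (C * (D + 1)), ?_⟩
  filter_upwards [hC, h.eventually (gt_mem_nhds (lt_add_one D))] with p hp hp'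
  refine (Pseudorep.norm_inverse_le hE.completeSpace hT (g p)).trans ?_
  have := (norm_nonneg _).trans hp
  gcongr

/-- If `s` tends to `T(g₀)⁻¹ e₀`, then `T(g)⁻¹ e - s = T(g)⁻¹ (e - T(g) s)`, where the vector in
parentheses tends to zero in norm and the inverses are locally bounded. -/
theorem Pseudorep.tendsto_inverse (hg : TendstoArr l g g₀) {e : ∀ p, E (y p)} {e₀ : E y₀}
    (he : TendstoIn E l e e₀) :
    TendstoIn E l (fun p => (T (g p)).inverse (e p)) ((T g₀).inverse e₀) := by
  have hE' := hE.toIsBanachBundle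
  have hinv := fun p => Pseudorep.isInvertible hE.completeSpace hT (g p)
  refine hE'.tendsto_of_sections (hG.tendsto_source hg) fun Q q m s hq hs => ?_
  obtain ⟨C, hC⟩ := Pseudorep.exists_norm_inverse_le hG hA hE hT hg
  have h1 := T.tendsto (hg.comp hq) (hs ((T g₀).inverse e₀))
  rw [(Pseudorep.isInvertible hE.completeSpace hT g₀).self_apply_inverse] at h1
  have h2 := (hE'.tendsto_norm_sub (he.comp hq) h1).const_mul C
  rw [mul_zero] at h2
  refine hE'.tendsto_of_norm_sub (hs _) (squeeze_zero' (.of_forall fun _ => norm_nonneg _) ?_ h2)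
  filter_upwards [hq.eventually hC] with i hi
  have h3 : (T (g (q i))).inverse (e (q i)) - s ((T g₀).inverse e₀) i =
      (T (g (q i))).inverse (e (q i) - T (g (q i)) (s ((T g₀).inverse e₀) i)) := by
    rw [map_sub, (hinv _).inverse_apply_self]
  rw [h3]
  exact ContinuousLinearMap.le_of_opNorm_le _ hi _

theorem Pseudorep.isHomeomorph_totalMap : IsHomeomorph T.totalMap := by
  have hinv := fun {x y : X} (g : x ⟶ y) => Pseudorep.isInvertible hE.completeSpace hT g
  let S : Pull (fun g : Arr X => g.right) E → Pull (fun g : Arr X => g.left) E :=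
    fun p => ⟨p.proj, (T p.proj.hom).inverse (vec p)⟩
  have hS : Continuous S := by
    rw [continuous_iff_continuousAt]
    intro p
    have h := tendsto_pull_iff.1 (tendsto_id : Tendsto id (𝓝 p) (𝓝 p))
    exact tendsto_pull_iff.2 ⟨h.1, Pseudorep.tendsto_inverse hG hA hE hT h.1 h.2⟩
  refine (Homeomorph.mk ⟨T.totalMap, S, fun p => ?_, fun p => ?_⟩
    T.continuous_toFun hS).isHomeomorph
  · exact congrArg (TotalSpace.mk p.proj) ((hinv p.proj.hom).inverse_apply_self _)
  · exact congrArg (TotalSpace.mk p.proj) ((hinv p.proj.hom).self_apply_inverse _)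

end

/-! ## Averages of operators -/

theorem opENorm_le_of_forall {V W : Type*} [NormedAddCommGroup V] [NormedSpace ℝ V]
    [NormedAddCommGroup W] [NormedSpace ℝ W] (f : V →L[ℝ] W) {C : ℝ≥0∞}
    (h : ∀ v, ‖f v‖ₑ ≤ C * ‖v‖ₑ) : ‖f‖ₑ ≤ C := by
  rcases eq_or_ne C ∞ with rfl | hC
  · exact le_top
  · lift C to NNReal using hC
    have : ‖f‖ ≤ C := f.opNorm_le_bound C.2 fun v => by
      have := ENNReal.toReal_mono (ENNReal.mul_ne_top ENNReal.coe_ne_top enorm_ne_top) (h v)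
      simpa using this
    rw [← ofReal_norm, ← ENNReal.ofReal_coe_nnreal]
    exact ENNReal.ofReal_le_ofReal this

theorem enorm_integral_le_of_forall {Ω : Type*} [MeasurableSpace Ω] {m : Measure Ω}
    [IsProbabilityMeasure m] {W : Type*} [NormedAddCommGroup W] [NormedSpace ℝ W] {f : Ω → W}
    {C : ℝ≥0∞} (h : ∀ ω, ‖f ω‖ₑ ≤ C) : ‖∫ ω, f ω ∂m‖ₑ ≤ C := by
  refine (enorm_integral_le_lintegral_enorm f).trans ((lintegral_mono h).trans ?_)
  simp

/-- The families to be averaged are in general only strongly continuous, so the integral is formed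
vector by vector; the uniform bound makes the result a bounded operator. -/
theorem InvariantMean.exists_integral_apply {X : Type*} [Groupoid X] [TopologicalSpace X]
    [TopologicalSpace (Arr X)] (ν : InvariantMean X) [T2Space X] [T2Space (Arr X)]
    (hG : IsTopologicalGroupoid X) {x : X} {V W : Type*} [NormedAddCommGroup V]
    [NormedSpace ℝ V] [NormedAddCommGroup W] [NormedSpace ℝ W] {F : TargetFiber X x → V →L[ℝ] W}
    (hF : ∀ v, Continuous fun h => F h v) {C : ℝ} (hC : ∀ h, ‖F h‖ ≤ C) :
    ∃ I : V →L[ℝ] W, ∀ v, I v = ∫ h, F h v ∂(ν.measure x) := by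
  have hi := fun v => ν.integrable hG (hF v)
  let L : V →ₗ[ℝ] W :=
    { toFun := fun v => ∫ h, F h v ∂(ν.measure x)
      map_add' := fun v w => by
        simp_rw [map_add]
        exact integral_add (hi v) (hi w)
      map_smul' := fun r v => by
        simp_rw [map_smul]
        exact integral_smul r _ }
  refine ⟨L.mkContinuous C fun v => ?_, fun v => rfl⟩
  refine (norm_integral_le_of_norm_le_const (C := C * ‖v‖) (ae_of_all _ fun h => ?_)).trans
    (by simp)
  exact ContinuousLinearMap.le_of_opNorm_le _ (hC h) _

/-! ### Algebra and estimates for the quotient operators -/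

section

variable {X : Type*} [Groupoid X] [TopologicalSpace (Arr X)] {A : X → Type*}
  [∀ x, NormedRing (A x)] [∀ x, NormedAlgebra ℝ (A x)] [TopologicalSpace (Tot A)]
  {α : AlgebraAction A} (σ : Multiplier α)
  {E : X → Type*} [∀ x, NormedAddCommGroup (E x)] [∀ x, NormedSpace ℝ (E x)]
  [∀ x, Module (A x) (E x)] [∀ x, IsBoundedSMul (A x) (E x)]
  [∀ x, IsScalarTower ℝ (A x) (E x)] [TopologicalSpace (Tot E)] (T : Pseudorep E)

/-- The operators `σ(g, h) T(gh) T(h)⁻¹`, the mean value of which is close to `T(g)`. -/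
def Pseudorep.quotient {x y z : X} (g : y ⟶ z) (h : x ⟶ y) : E y →L[ℝ] E z :=
  (σ g h : A z) • (T (h ≫ g)).comp (T h).inverse

theorem Pseudorep.quotient_apply {x y z : X} (g : y ⟶ z) (h : x ⟶ y) (e : E y) :
    T.quotient σ g h e = (σ g h : A z) • T (h ≫ g) ((T h).inverse e) := rfl

/-- Pseudorepresentations that satisfy the numerical conditions which averaging preserves. -/
structure Pseudorep.IsNearRepresentation : Prop where
  isLinear : T.IsLinear α
  defect_le : ∀ x, T.defect σ x ≤ 1 / 4
  bound_sq_mul_defect_le : ∀ x, T.bound σ x ^ 2 * T.defect σ x ≤ 1 / 9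

variable {σ T}

theorem Pseudorep.IsAlmostRepresentation.isNearRepresentation
    (hT : T.IsAlmostRepresentation σ) : T.IsNearRepresentation σ where
  isLinear := hT.isLinear
  defect_le x := (hT.defect_le x).trans (min_le_left _ _)
  bound_sq_mul_defect_le x := by
    refine (mul_le_mul_right ((hT.defect_le x).trans (min_le_right _ _)) _).trans ?_
    rw [← mul_div_assoc]
    exact ENNReal.div_le_div_right (ENNReal.mul_inv_le_one _) _

theorem Multiplier.one_le_ell {x y : X} (g : x ⟶ y) : 1 ≤ σ.ell g := le_max_left _ _

theorem Multiplier.ell_ne_zero {x y : X} (g : x ⟶ y) : σ.ell g ≠ 0 :=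
  (zero_lt_one.trans_le (Multiplier.one_le_ell g)).ne'

theorem Multiplier.ell_ne_top {x y : X} (g : x ⟶ y) : σ.ell g ≠ ∞ :=
  (max_lt ENNReal.one_lt_top enorm_lt_top).ne

variable (hE : ∀ x, CompleteSpace (E x)) (hT : T.IsNearRepresentation σ)

-- For `b ≤ 1` the bound on `r` suffices; for `b ≥ 1` one has `b r ≤ b² r ≤ 1 / 9`.
include hT in
theorem Pseudorep.IsNearRepresentation.bound_mul_defect_le (x : X) :
    T.bound σ x * T.defect σ x ≤ 1 / 4 := by
  rcases le_total (T.bound σ x) 1 with h | h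
  · exact (mul_le_mul_left h _).trans (by rw [one_mul]; exact hT.defect_le x)
  · refine (mul_le_mul_left ?_ _).trans ((hT.bound_sq_mul_defect_le x).trans
      (ENNReal.div_le_div_left (by norm_num) _))
    rw [sq]
    exact le_mul_of_one_le_left' h

include hE hT

/-- The difference is `(σ(g, h) T(gh) - T(g) T(h)) T(h)⁻¹`: the weighted first factor is at most
`r`, the second at most `4 b / 3`. -/
theorem Pseudorep.ell_mul_enorm_quotient_sub_le {x y z : X} (g : y ⟶ z) (h : x ⟶ y) :
    σ.ell g * ‖T.quotient σ g h - T g‖ₑ ≤ 4 / 3 * (T.bound σ z * T.defect σ z) := by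
  have hinv := Pseudorep.isInvertible hE hT.defect_le h
  have h1 : T.quotient σ g h - T g =
      ((σ g h : A z) • T (h ≫ g) - (T g).comp (T h)).comp (T h).inverse := by
    ext e
    simp [Pseudorep.quotient_apply, hinv.self_apply_inverse]
  rw [h1]
  calc σ.ell g * ‖((σ g h : A z) • T (h ≫ g) - (T g).comp (T h)).comp (T h).inverse‖ₑ
      ≤ σ.ell g * (‖(σ g h : A z) • T (h ≫ g) - (T g).comp (T h)‖ₑ * ‖(T h).inverse‖ₑ) :=
        mul_le_mul_right (enorm_comp_le _ _) _
    _ = (σ.ell g * ‖(σ g h : A z) • T (h ≫ g) - (T g).comp (T h)‖ₑ) * ‖(T h).inverse‖ₑ :=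
        (mul_assoc _ _ _).symm
    _ ≤ T.defect σ z * (4 / 3 * T.bound σ z) := by
        rw [← T.bound_congr σ g]
        exact mul_le_mul' (T.ell_mul_le_defect σ g h)
          (Pseudorep.enorm_inverse_le hE hT.defect_le h)
    _ = _ := by ring

theorem Pseudorep.enorm_quotient_sub_le {x y z : X} (g : y ⟶ z) (h : x ⟶ y) :
    ‖T.quotient σ g h - T g‖ₑ ≤ 4 / 3 * (T.bound σ z * T.defect σ z) / σ.ell g := by
  rw [ENNReal.le_div_iff_mul_le (.inl (Multiplier.ell_ne_zero g)) (.inl (Multiplier.ell_ne_top g)),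
    mul_comm]
  exact Pseudorep.ell_mul_enorm_quotient_sub_le hE hT g h

theorem Pseudorep.norm_quotient_le {x y z : X} (g : y ⟶ z) (h : x ⟶ y) :
    ‖T.quotient σ g h‖ ≤ ‖T g‖ + 1 := by
  have h1 : ‖T.quotient σ g h - T g‖ₑ ≤ 1 := by
    refine (le_mul_of_one_le_left' (Multiplier.one_le_ell g)).trans
      ((Pseudorep.ell_mul_enorm_quotient_sub_le hE hT g h).trans
        ((mul_le_mul_right (hT.bound_mul_defect_le z) _).trans ?_))
    rw [← ENNReal.toReal_le_toReal (by finiteness) (by simp)]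
    simp
    norm_num
  have h2 : ‖T.quotient σ g h - T g‖ ≤ 1 := by
    rw [← toReal_enorm]
    simpa using ENNReal.toReal_mono ENNReal.one_ne_top h1
  have := norm_le_norm_add_norm_sub' (T.quotient σ g h) (T g)
  linarith

theorem Pseudorep.quotient_map_smul {x y z : X} (g : y ⟶ z) (h : x ⟶ y) (a : A y) (e : E y) :
    T.quotient σ g h (a • e) = α.act g a • T.quotient σ g h e := by
  have hinv := Pseudorep.isInvertible hE hT.defect_le h
  have h1 : (T h).inverse (a • e) = α.act (Groupoid.inv h) a • (T h).inverse e := by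
    refine Pseudorep.injective hE hT.defect_le h ?_
    rw [hinv.self_apply_inverse, hT.isLinear, hinv.self_apply_inverse, ← α.act_comp,
      Groupoid.inv_comp, α.act_id]
  rw [T.quotient_apply, T.quotient_apply, h1, hT.isLinear, ← α.act_comp, smul_smul, smul_smul,
    σ.central, ← Category.assoc, Groupoid.inv_comp, Category.id_comp]

theorem Pseudorep.quotient_id {x y : X} (h : x ⟶ y) (e : E y) : T.quotient σ (𝟙 y) h e = e := by
  rw [T.quotient_apply, σ.normal_left, Category.comp_id,
    (Pseudorep.isInvertible hE hT.defect_le h).self_apply_inverse, Units.val_one, one_smul]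

/-- In the product, `T(hk)⁻¹` cancels `T(hk)` after `σ(h, k)` has been moved out as `g σ(h, k)`, and
the cocycle identity rewrites the remaining coefficients. So multiplicativity is exact before
averaging; only the means fail to be multiplicative. -/
theorem Pseudorep.quotient_quotient {w x y z : X} (g : y ⟶ z) (h : x ⟶ y) (k : w ⟶ x)
    (e : E x) : T.quotient σ g (k ≫ h) (T.quotient σ h k e) =
      (σ g h : A z) • T.quotient σ (h ≫ g) k e := by
  have hinv := Pseudorep.isInvertible hE hT.defect_le (k ≫ h)
  rw [T.quotient_apply σ h k, Pseudorep.quotient_map_smul hE hT, T.quotient_apply,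
    hinv.inverse_apply_self, T.quotient_apply, smul_smul, smul_smul, σ.cocycle, Category.assoc]

end

/-! ### The averaged pseudorepresentation and its defect -/

section

variable {X : Type*} [Groupoid X] [TopologicalSpace X] [TopologicalSpace (Arr X)]
  (hG : IsTopologicalGroupoid X) {A : X → Type*}
  [∀ x, NormedRing (A x)] [∀ x, NormOneClass (A x)] [∀ x, NormedAlgebra ℝ (A x)]
  [TopologicalSpace (Tot A)] (hA : IsBanachAlgebraBundle A)
  {α : AlgebraAction A} {σ : Multiplier α}
  {E : X → Type*} [∀ x, NormedAddCommGroup (E x)] [∀ x, NormedSpace ℝ (E x)]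
  [∀ x, Module (A x) (E x)] [∀ x, IsBoundedSMul (A x) (E x)]
  [∀ x, IsScalarTower ℝ (A x) (E x)] [TopologicalSpace (Tot E)]
  (hE : IsBanachModuleBundle A E) {T : Pseudorep E} (hT : T.IsNearRepresentation σ)

include hG hA hE hT

theorem Pseudorep.tendsto_quotient {P : Type*} {l : Filter P} {x y z : P → X}
    {g : ∀ p, y p ⟶ z p} {h : ∀ p, x p ⟶ y p} {x₀ y₀ z₀ : X} {g₀ : y₀ ⟶ z₀} {h₀ : x₀ ⟶ y₀}
    (hg : TendstoArr l g g₀) (hh : TendstoArr l h h₀) {e : ∀ p, E (y p)} {e₀ : E y₀}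
    (he : TendstoIn E l e e₀) :
    TendstoIn E l (fun p => T.quotient σ (g p) (h p) (e p)) (T.quotient σ g₀ h₀ e₀) :=
  hE.tendsto_smul' (σ.tendsto hg hh) (T.tendsto (hG.tendsto_comp hg hh)
    (Pseudorep.tendsto_inverse hG hA hE hT.defect_le hh he))

theorem Pseudorep.continuous_quotient {x y : X} (g : x ⟶ y) (e : E x) :
    Continuous fun h : TargetFiber X x => T.quotient σ g h.hom e := by
  refine hE.continuous_of_continuous_total (continuous_iff_continuousAt.2 fun h => ?_)
  exact Pseudorep.tendsto_quotient hG hA hE hT (g := fun _ => g)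
    (h := fun h : TargetFiber X x => h.hom) (e := fun _ => e) tendsto_const_nhds
    ((TargetFiber.continuous_toArr x).tendsto h) tendsto_const_nhds

variable [T2Space X] [T2Space (Arr X)] (ν : InvariantMean X)

/-- Existence of the average of an almost representation. -/
theorem Pseudorep.exists_average [LocallyCompactSpace (Arr X)] :
    ∃ R : Pseudorep E, ∀ ⦃x y : X⦄ (g : x ⟶ y) (e : E x),
      R g e = ∫ h, T.quotient σ g h.hom e ∂(ν.measure x) := by
  have hE' := hE.toIsBanachBundle
  have := hE.completeSpace
  have hI : ∀ (x y : X) (g : x ⟶ y), ∃ I : E x →L[ℝ] E y, ∀ e,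
      I e = ∫ h, T.quotient σ g h.hom e ∂(ν.measure x) := fun x y g =>
    ν.exists_integral_apply hG (Pseudorep.continuous_quotient hG hA hE hT g)
      fun h => Pseudorep.norm_quotient_le hE.completeSpace hT g h.hom
  choose I hI using hI
  refine ⟨⟨fun x y g => I x y g, ?_⟩, fun x y g e => hI x y g e⟩
  rw [continuous_iff_continuousAt]
  intro p₀
  obtain ⟨hg, he⟩ := tendsto_pull_iff.1 (tendsto_id : Tendsto id (𝓝 p₀) (𝓝 p₀))
  refine tendsto_pull_iff.2 ⟨hg, ?_⟩
  refine hE'.tendsto_of_sections (hG.tendsto_target hg) fun Q q m s hq hs => ?_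
  refine hE'.tendsto_of_norm_sub (hs _) ?_
  -- The integrands take values in different fibers; the family `s` transports the limit integrand
  -- to nearby fibers, with joint convergence in the arrow and in `h`.
  have key := ν.tendsto_integral hG ((hG.tendsto_source hg).comp hq)
    (hE'.isAsymptoticallyLinear hs)
    (f := fun i h => T.quotient σ (q i).proj.hom h.hom (vec (q i)))
    (f₀ := fun h => T.quotient σ p₀.proj.hom h.hom (vec p₀))
    (.of_forall fun i => Pseudorep.continuous_quotient hG hA hE hT _ _)
    (Pseudorep.continuous_quotient hG hA hE hT _ _) fun h₀ => ?_
  · refine key.congr fun i => ?_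
    rw [← hI]
    exact congrArg (fun a => ‖_ - s a i‖) (hI _ _ _ _).symm
  have hc : Tendsto (fun p : Σ i, TargetFiber X (q i).proj.left => (p.1, p.2.toArr))
      (comap (fun p => (p.1, p.2.toArr)) (m ×ˢ 𝓝 h₀.toArr)) (m ×ˢ 𝓝 h₀.toArr) := tendsto_comap
  have hq' := hq.comp (tendsto_fst.comp hc)
  exact hE'.tendsto_norm_sub
    (Pseudorep.tendsto_quotient hG hA hE hT (hg.comp hq')
      (h := fun p : Σ i, TargetFiber X (q i).proj.left => p.2.hom) (h₀ := h₀.hom)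
      (tendsto_snd.comp hc) (he.comp hq'))
    ((hs _).comp (tendsto_fst.comp hc))

variable {R : Pseudorep E} (hR : ∀ ⦃x y : X⦄ (g : x ⟶ y) (e : E x),
  R g e = ∫ h, T.quotient σ g h.hom e ∂(ν.measure x))

include hR

theorem Pseudorep.isLinear_average : R.IsLinear α := by
  intro x y g a e
  have := hE.completeSpace y
  let L : E y →L[ℝ] E y := α.act g a • ContinuousLinearMap.id ℝ (E y)
  have h := L.integral_comp_comm
    (ν.integrable hG (Pseudorep.continuous_quotient hG hA hE hT g e))
  rw [hR, hR]
  simp_rw [Pseudorep.quotient_map_smul hE.completeSpace hT]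
  exact h

omit hG hA [T2Space X] [T2Space (Arr X)] in
theorem Pseudorep.average_id (x : X) : R (𝟙 x) = ContinuousLinearMap.id ℝ (E x) := by
  have := hE.completeSpace x
  ext e
  rw [hR]
  simp_rw [Pseudorep.quotient_id hE.completeSpace hT]
  simp

theorem Pseudorep.average_sub_apply {x y : X} (g : x ⟶ y) (e : E x) :
    R g e - T g e = ∫ h : TargetFiber X x, (T.quotient σ g h.hom e - T g e) ∂(ν.measure x) := by
  have := hE.completeSpace y
  rw [integral_sub (ν.integrable hG (Pseudorep.continuous_quotient hG hA hE hT g e))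
    (integrable_const _), hR]
  simp

theorem Pseudorep.enorm_average_sub_le {x y : X} (g : x ⟶ y) :
    ‖R g - T g‖ₑ ≤ 4 / 3 * (T.bound σ y * T.defect σ y) / σ.ell g := by
  refine opENorm_le_of_forall _ fun e => ?_
  rw [sub_apply, Pseudorep.average_sub_apply hG hA hE hT ν hR]
  refine enorm_integral_le_of_forall fun h => ?_
  exact ((T.quotient σ g h.hom - T g).le_opENorm e).trans
    (mul_le_mul_left (Pseudorep.enorm_quotient_sub_le hE.completeSpace hT g h.hom) _)

/-- Expanding the integral gives `σ(g, h) R(gh) - R(g) T(h) - T(g) R(h) + T(g) T(h)`, by exact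
multiplicativity of the quotients for the first term. Subtracting the expansion of `(R(g) - T(g))
(R(h) - T(h))` removes all mixed terms. -/
theorem Pseudorep.average_comp_apply {x y z : X} (g : y ⟶ z) (h : x ⟶ y) (e : E x) :
    (σ g h : A z) • R (h ≫ g) e - R g (R h e) =
      (∫ k : TargetFiber X x, (T.quotient σ g (k.hom ≫ h) - T g)
        ((T.quotient σ h k.hom - T h) e) ∂(ν.measure x)) - (R g - T g) ((R h - T h) e) := by
  have := hE.completeSpace y
  have := hE.completeSpace z
  let L : E z →L[ℝ] E z := (σ g h : A z) • ContinuousLinearMap.id ℝ (E z)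
  have hc := fun {y z : X} (g : y ⟶ z) (e : E y) =>
    Pseudorep.continuous_quotient hG hA hE hT g e
  have h1 : (σ g h : A z) • R (h ≫ g) e =
      ∫ k : TargetFiber X x, L (T.quotient σ (h ≫ g) k.hom e) ∂(ν.measure x) := by
    rw [L.integral_comp_comm (ν.integrable hG (hc _ _)), ← hR]
    rfl
  -- Left invariance of the mean enters here, substituting `hk` for the integration variable.
  have h2 : R g (T h e) =
      ∫ k : TargetFiber X x, T.quotient σ g (k.hom ≫ h) (T h e) ∂(ν.measure x) := by
    rw [hR]
    exact (ν.integral_mulLeft hG h fun k : TargetFiber X y => T.quotient σ g k.hom (T h e)).symm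
  have h3 : T g (R h e) = ∫ k : TargetFiber X x, T g (T.quotient σ h k.hom e) ∂(ν.measure x) := by
    rw [(T g).integral_comp_comm (ν.integrable hG (hc _ _)), ← hR]
  have h4 : (fun k : TargetFiber X x =>
      (T.quotient σ g (k.hom ≫ h) - T g) ((T.quotient σ h k.hom - T h) e)) = fun k =>
      (L (T.quotient σ (h ≫ g) k.hom e) - T.quotient σ g (k.hom ≫ h) (T h e)) -
        (T g (T.quotient σ h k.hom e) - T g (T h e)) := by
    ext k
    have h5 : L (T.quotient σ (h ≫ g) k.hom e) =
        T.quotient σ g (k.hom ≫ h) (T.quotient σ h k.hom e) :=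
      (Pseudorep.quotient_quotient hE.completeSpace hT g h k.hom e).symm
    rw [h5]
    simp only [sub_apply, map_sub]
    abel
  have i1 : Integrable (fun k : TargetFiber X x => L (T.quotient σ (h ≫ g) k.hom e))
      (ν.measure x) := ν.integrable hG (L.continuous.comp (hc _ _))
  have i2 : Integrable (fun k : TargetFiber X x => T.quotient σ g (k.hom ≫ h) (T h e))
      (ν.measure x) :=
    ν.integrable hG ((hc g (T h e)).comp (TargetFiber.continuous_mulLeft hG h))
  have i3 : Integrable (fun k : TargetFiber X x => T g (T.quotient σ h k.hom e))
      (ν.measure x) := ν.integrable hG ((T g).continuous.comp (hc _ _))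
  have i4 : Integrable (fun _ : TargetFiber X x => T g (T h e)) (ν.measure x) :=
    integrable_const _
  have s1 := integral_sub (i1.sub i2) (i3.sub i4)
  have s2 := integral_sub i1 i2
  have s3 := integral_sub i3 i4
  simp only [Pi.sub_apply] at s1
  rw [h4, s1, s2, s3, ← h1, ← h2, ← h3]
  simp only [sub_apply, map_sub, integral_const, probReal_univ, one_smul]
  abel

/-- Both terms of `average_comp_apply` are bounded by `(δ / ℓ(σ, g)) δ`, whence the factor `2`; the
weight `ℓ(σ, g)` is absorbed by the first factor. -/
theorem Pseudorep.enorm_average_comp_le {x y z : X} (g : y ⟶ z) (h : x ⟶ y) :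
    σ.ell g * ‖(σ g h : A z) • R (h ≫ g) - (R g).comp (R h)‖ₑ ≤
      2 * (4 / 3 * (T.bound σ z * T.defect σ z)) ^ 2 := by
  set δ := 4 / 3 * (T.bound σ z * T.defect σ z)
  have hδ : 4 / 3 * (T.bound σ y * T.defect σ y) / σ.ell h ≤ δ := by
    rw [T.bound_congr σ g, T.defect_congr σ g]
    exact ENNReal.div_le_of_le_mul (le_mul_of_one_le_right' (Multiplier.one_le_ell h))
  have h1 : ‖(σ g h : A z) • R (h ≫ g) - (R g).comp (R h)‖ₑ ≤ 2 * (δ / σ.ell g * δ) := by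
    refine opENorm_le_of_forall _ fun e => ?_
    have e1 : ((σ g h : A z) • R (h ≫ g) - (R g).comp (R h)) e =
        (σ g h : A z) • R (h ≫ g) e - R g (R h e) := rfl
    rw [e1, Pseudorep.average_comp_apply hG hA hE hT ν hR, two_mul, add_mul]
    refine (enorm_sub_le (E := E z)).trans (add_le_add ?_ ?_)
    · refine enorm_integral_le_of_forall fun k => ?_
      refine (ContinuousLinearMap.le_opENorm _ _).trans ?_
      rw [mul_assoc]
      refine mul_le_mul' (Pseudorep.enorm_quotient_sub_le hE.completeSpace hT g _) ?_
      refine (ContinuousLinearMap.le_opENorm _ _).trans (mul_le_mul_left ?_ _)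
      exact (Pseudorep.enorm_quotient_sub_le hE.completeSpace hT h _).trans hδ
    · refine (ContinuousLinearMap.le_opENorm _ _).trans ?_
      rw [mul_assoc]
      refine mul_le_mul' (Pseudorep.enorm_average_sub_le hG hA hE hT ν hR g) ?_
      refine (ContinuousLinearMap.le_opENorm _ _).trans (mul_le_mul_left ?_ _)
      exact (Pseudorep.enorm_average_sub_le hG hA hE hT ν hR h).trans hδ
  calc σ.ell g * ‖(σ g h : A z) • R (h ≫ g) - (R g).comp (R h)‖ₑ
      ≤ σ.ell g * (2 * (δ / σ.ell g * δ)) := mul_le_mul_right h1 _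
    _ = 2 * (σ.ell g * (δ / σ.ell g) * δ) := by ring
    _ ≤ 2 * (δ * δ) := by
        gcongr
        exact ENNReal.mul_div_le
    _ = 2 * δ ^ 2 := by rw [sq]

end

/-! ## Local matrix expressions -/

/-- Replacing functions on an open subtype by total ones avoids membership proofs inside limits. -/
theorem exists_continuousAt_extension {Y Z : Type*} [TopologicalSpace Y] [TopologicalSpace Z]
    [Zero Z] {D : Set Y} (hD : IsOpen D) {f : D → Z} (hf : Continuous f) {y : Y} (hy : y ∈ D) :
    ∃ F : Y → Z, ContinuousAt F y ∧ ∀ y (h : y ∈ D), F y = f ⟨y, h⟩ := by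
  classical
  have hF : ∀ y (h : y ∈ D), (if h : y ∈ D then f ⟨y, h⟩ else 0) = f ⟨y, h⟩ := fun y h => dif_pos h
  refine ⟨_, ContinuousOn.continuousAt ?_ (hD.mem_nhds hy), hF⟩
  rw [continuousOn_iff_continuous_domRestrict]
  exact hf.congr fun y => (hF y.1 y.2).symm

theorem tendsto_clm_comp {P : Type*} {l : Filter P} {V W U : Type*} [NormedAddCommGroup V]
    [NormedSpace ℝ V] [NormedAddCommGroup W] [NormedSpace ℝ W] [NormedAddCommGroup U]
    [NormedSpace ℝ U] {f : P → W →L[ℝ] U} {g : P → V →L[ℝ] W} {f₀ : W →L[ℝ] U} {g₀ : V →L[ℝ] W}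
    (hf : Tendsto f l (𝓝 f₀)) (hg : Tendsto g l (𝓝 g₀)) :
    Tendsto (fun p => (f p).comp (g p)) l (𝓝 (f₀.comp g₀)) :=
  ((continuous_fst.clm_comp continuous_snd).tendsto (f₀, g₀)).comp (hf.prodMk_nhds hg)

theorem inverse_conj {V E F : Type*} [NormedAddCommGroup V] [NormedSpace ℝ V]
    [NormedAddCommGroup E] [NormedSpace ℝ E] [NormedAddCommGroup F] [NormedSpace ℝ F]
    (a : V ≃L[ℝ] E) (b : V ≃L[ℝ] F) {f : E →L[ℝ] F} (hf : f.IsInvertible) :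
    ((b.symm : F →L[ℝ] V).comp (f.comp (a : V →L[ℝ] E))).inverse =
      (a.symm : E →L[ℝ] V).comp (f.inverse.comp (b : V →L[ℝ] F)) := by
  obtain ⟨e, rfl⟩ := hf
  rw [ContinuousLinearMap.inverse_equiv]
  exact ContinuousLinearMap.inverse_equiv ((a.trans e).trans b.symm)

section

variable {X : Type*} [TopologicalSpace X] {A : X → Type*}
  [∀ x, NormedRing (A x)] [∀ x, NormedAlgebra ℝ (A x)] [TopologicalSpace (Tot A)]
  {E : X → Type*} [∀ x, NormedAddCommGroup (E x)] [∀ x, NormedSpace ℝ (E x)]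
  [∀ x, Module (A x) (E x)] [∀ x, IsBoundedSMul (A x) (E x)]
  [∀ x, IsScalarTower ℝ (A x) (E x)] [TopologicalSpace (Tot E)]
  {V : Type*} [NormedAddCommGroup V] [NormedSpace ℝ V]

namespace LocalTrivialization

variable (φ ψ : LocalTrivialization A E V)

open Classical in
/-- A local trivialization at a point, extended by zero. -/
def coord (x : X) : V →L[ℝ] E x := if h : x ∈ φ.baseSet then φ.equiv ⟨x, h⟩ else 0

open Classical in
/-- The inverse of a local trivialization at a point, extended by zero. -/
def coordSymm (x : X) : E x →L[ℝ] V :=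
  if h : x ∈ φ.baseSet then (φ.equiv ⟨x, h⟩).symm else 0

theorem coord_of_mem {x : X} (h : x ∈ φ.baseSet) : φ.coord x = φ.equiv ⟨x, h⟩ := dif_pos h

theorem coordSymm_of_mem {x : X} (h : x ∈ φ.baseSet) :
    φ.coordSymm x = (φ.equiv ⟨x, h⟩).symm := dif_pos h

theorem coord_coordSymm {x : X} (h : x ∈ φ.baseSet) (e : E x) :
    φ.coord x (φ.coordSymm x e) = e := by
  simp [coord_of_mem, coordSymm_of_mem, h]

theorem tendsto_scalar (hA : IsBanachBundle A) {P : Type*} {l : Filter P} {x : P → X} {x₀ : X}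
    (hx₀ : x₀ ∈ φ.baseSet) {a : ∀ p, A (x p)} {a₀ : A x₀} (ha : TendstoIn A l a a₀) :
    Tendsto (fun p => (φ.coordSymm (x p)).comp
      ((a p • ContinuousLinearMap.id ℝ (E (x p))).comp (φ.coord (x p)))) l
      (𝓝 ((φ.coordSymm x₀).comp ((a₀ • ContinuousLinearMap.id ℝ (E x₀)).comp (φ.coord x₀)))) := by
  have hD : IsOpen {a : Tot A | a.proj ∈ φ.baseSet} :=
    φ.isOpen_baseSet.preimage hA.continuous_proj
  obtain ⟨F, hF, hFD⟩ := exists_continuousAt_extension hD φ.continuous_scalar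
    (y := ⟨x₀, a₀⟩) hx₀
  have hF' : ∀ (x : X) (a : A x), x ∈ φ.baseSet → F ⟨x, a⟩ = (φ.coordSymm x).comp
      ((a • ContinuousLinearMap.id ℝ (E x)).comp (φ.coord x)) := fun x a hx => by
    rw [hFD ⟨x, a⟩ hx, φ.coord_of_mem hx, φ.coordSymm_of_mem hx]
  rw [← hF' x₀ a₀ hx₀]
  refine (hF.tendsto.comp ha).congr' ?_
  filter_upwards [hA.tendsto_proj ha (φ.isOpen_baseSet.mem_nhds hx₀)] with p hp
  exact hF' _ _ hp

end LocalTrivialization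

variable (S : GIStructure A E V)

theorem GIStructure.norm_coord_le {φ : LocalTrivialization A E V} (hφ : φ ∈ S.atlas) (x : X) :
    ‖φ.coord x‖ ≤ 1 := by
  refine ContinuousLinearMap.opNorm_le_bound _ zero_le_one fun v => ?_
  by_cases h : x ∈ φ.baseSet
  · rw [φ.coord_of_mem h, one_mul]
    exact (S.isometric φ hφ ⟨x, h⟩ v).le
  · simp [LocalTrivialization.coord, h]

theorem GIStructure.norm_coordSymm_le {φ : LocalTrivialization A E V} (hφ : φ ∈ S.atlas) (x : X) :
    ‖φ.coordSymm x‖ ≤ 1 := by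
  refine ContinuousLinearMap.opNorm_le_bound _ zero_le_one fun e => ?_
  by_cases h : x ∈ φ.baseSet
  · rw [one_mul, φ.coordSymm_of_mem h]
    refine (S.isometric φ hφ ⟨x, h⟩ _).ge.trans ?_
    simp
  · simp [LocalTrivialization.coordSymm, h]

variable [Groupoid X] [TopologicalSpace (Arr X)]

/-- The local matrix expression of a pseudorepresentation, extended by zero. -/
def Pseudorep.localMatrix (φ ψ : LocalTrivialization A E V) (T : Pseudorep E) {x y : X}
    (g : x ⟶ y) : V →L[ℝ] V := (ψ.coordSymm y).comp ((T g).comp (φ.coord x))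

variable {S}

omit [Groupoid X] [TopologicalSpace (Arr X)] in
theorem GIStructure.isPullbackTrivialization {Y : Type*} [TopologicalSpace Y] {u : Y → X}
    (hu : Continuous u) {W : Set Y} (hW : IsOpen W) {φ : LocalTrivialization A E V}
    (hφ : φ ∈ S.atlas) (hWφ : ∀ w ∈ W, u w ∈ φ.baseSet) :
    S.IsPullbackTrivialization u W fun w => φ.equiv ⟨u w, hWφ w w.2⟩ := by
  refine ⟨hW, fun ψ hψ => ?_⟩
  exact (S.compatible φ hφ ψ hψ).comp (f := fun w : {w : Y // w ∈ W ∧ u w ∈ ψ.baseSet} =>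
    ⟨u w.1, hWφ w.1 w.2.1, w.2.2⟩) ((hu.comp continuous_subtype_val).subtype_mk _)

theorem Pseudorep.IsUniformlyContinuous.tendsto_localMatrix (hG : IsTopologicalGroupoid X)
    {T : Pseudorep E} (hT : T.IsUniformlyContinuous S) {φ ψ : LocalTrivialization A E V}
    (hφ : φ ∈ S.atlas) (hψ : ψ ∈ S.atlas) {P : Type*} {l : Filter P} {x y : P → X} {x₀ y₀ : X}
    {g : ∀ p, x p ⟶ y p} {g₀ : x₀ ⟶ y₀} (hg : TendstoArr l g g₀) (hx₀ : x₀ ∈ φ.baseSet)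
    (hy₀ : y₀ ∈ ψ.baseSet) :
    Tendsto (fun p => T.localMatrix φ ψ (g p)) l (𝓝 (T.localMatrix φ ψ g₀)) := by
  let W : Set (Arr X) := {g | g.left ∈ φ.baseSet ∧ g.right ∈ ψ.baseSet}
  have hW : IsOpen W := (φ.isOpen_baseSet.preimage hG.continuous_source).inter
    (ψ.isOpen_baseSet.preimage hG.continuous_target)
  have h := hT W _ _
    (S.isPullbackTrivialization hG.continuous_source hW hφ fun w hw => hw.1)
    (S.isPullbackTrivialization hG.continuous_target hW hψ fun w hw => hw.2)
  have h0 : (⟨x₀, y₀, g₀⟩ : Arr X) ∈ W := ⟨hx₀, hy₀⟩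
  have h1 : ContinuousAt (fun g : Arr X => T.localMatrix φ ψ g.hom) ⟨x₀, y₀, g₀⟩ := by
    refine ContinuousOn.continuousAt ?_ (hW.mem_nhds h0)
    rw [continuousOn_iff_continuous_domRestrict]
    refine h.congr fun g => ?_
    simp only [Set.domRestrict_apply, Pseudorep.localMatrix]
    rw [φ.coord_of_mem g.2.1, ψ.coordSymm_of_mem g.2.2]
  exact h1.tendsto.comp hg

/-- Arbitrary admissible trivializations differ from the charts by norm continuous transition
functions `F` and `B`, so the matrix becomes `B⁻¹ M F`. Inversion is norm continuous at invertible
operators of the Banach space `V`. -/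
theorem Pseudorep.isUniformlyContinuous_of_continuousAt [CompleteSpace V]
    (hG : IsTopologicalGroupoid X) {T : Pseudorep E}
    (hT : ∀ φ ∈ S.atlas, ∀ ψ ∈ S.atlas, ∀ g : Arr X, g.left ∈ φ.baseSet → g.right ∈ ψ.baseSet →
      ContinuousAt (fun g : Arr X => T.localMatrix φ ψ g.hom) g) : T.IsUniformlyContinuous S := by
  intro W φ' ψ' hφ' hψ'
  rw [continuous_iff_continuousAt]
  intro g₀
  obtain ⟨φ, hφ, hx₀⟩ := S.covers g₀.1.left
  obtain ⟨ψ, hψ, hy₀⟩ := S.covers g₀.1.right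
  have hDφ : IsOpen {g : Arr X | g ∈ W ∧ g.left ∈ φ.baseSet} :=
    hφ'.1.inter (φ.isOpen_baseSet.preimage hG.continuous_source)
  have hDψ : IsOpen {g : Arr X | g ∈ W ∧ g.right ∈ ψ.baseSet} :=
    hψ'.1.inter (ψ.isOpen_baseSet.preimage hG.continuous_target)
  obtain ⟨F, hF, hFD⟩ := exists_continuousAt_extension hDφ (hφ'.2 φ hφ) (y := g₀.1) ⟨g₀.2, hx₀⟩
  obtain ⟨B, hB, hBD⟩ := exists_continuousAt_extension hDψ (hψ'.2 ψ hψ) (y := g₀.1) ⟨g₀.2, hy₀⟩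
  have hinv : ContinuousAt ContinuousLinearMap.inverse (B g₀.1) := by
    rw [hBD g₀.1 ⟨g₀.2, hy₀⟩]
    exact (contDiffAt_map_inverse (𝕜 := ℝ) (n := 0)
      ((ψ' g₀).trans (ψ.equiv ⟨g₀.1.right, hy₀⟩).symm)).continuousAt
  have hcomp := (tendsto_clm_comp (hinv.comp hB) (tendsto_clm_comp
    (hT φ hφ ψ hψ g₀.1 hx₀ hy₀) hF)).comp (continuous_subtype_val.tendsto g₀)
  refine ContinuousAt.congr (f := fun g : W => (B g.1).inverse.comp
    ((T.localMatrix φ ψ g.1.hom).comp (F g.1))) hcomp ?_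
  have e1 : ∀ᶠ g : W in 𝓝 g₀, g.1.left ∈ φ.baseSet ∧ g.1.right ∈ ψ.baseSet :=
    ((φ.isOpen_baseSet.preimage (hG.continuous_source.comp continuous_subtype_val)).inter
      (ψ.isOpen_baseSet.preimage (hG.continuous_target.comp continuous_subtype_val))).mem_nhds
      ⟨hx₀, hy₀⟩
  filter_upwards [e1] with g hg
  simp only [Pseudorep.localMatrix]
  rw [hFD g.1 ⟨g.2, hg.1⟩, hBD g.1 ⟨g.2, hg.2⟩, φ.coord_of_mem hg.1, ψ.coordSymm_of_mem hg.2]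
  have e2 := ContinuousLinearMap.inverse_equiv ((ψ' g).trans (ψ.equiv ⟨g.1.right, hg.2⟩).symm)
  have e3 : (((ψ' g).trans (ψ.equiv ⟨g.1.right, hg.2⟩).symm : V ≃L[ℝ] V) : V →L[ℝ] V) =
    ((ψ.equiv ⟨g.1.right, hg.2⟩).symm : E g.1.right →L[ℝ] V).comp
      (ψ' g : V →L[ℝ] E g.1.right) := rfl
  rw [← e3, e2]
  ext v
  simp

end

/-! ## Uniform continuity of averages -/

section

variable {X : Type*} [Groupoid X] [TopologicalSpace X] [TopologicalSpace (Arr X)]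
  (hG : IsTopologicalGroupoid X) {A : X → Type*}
  [∀ x, NormedRing (A x)] [∀ x, NormOneClass (A x)] [∀ x, NormedAlgebra ℝ (A x)]
  [TopologicalSpace (Tot A)] (hA : IsBanachAlgebraBundle A)
  {α : AlgebraAction A} {σ : Multiplier α}
  {E : X → Type*} [∀ x, NormedAddCommGroup (E x)] [∀ x, NormedSpace ℝ (E x)]
  [∀ x, Module (A x) (E x)] [∀ x, IsBoundedSMul (A x) (E x)]
  [∀ x, IsScalarTower ℝ (A x) (E x)] [TopologicalSpace (Tot E)]
  (hE : IsBanachModuleBundle A E) {T : Pseudorep E} (hT : T.IsNearRepresentation σ)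
  {V : Type*} [NormedAddCommGroup V] [NormedSpace ℝ V] [CompleteSpace V]
  {S : GIStructure A E V} (hTS : T.IsUniformlyContinuous S)

include hG hA hE hT hTS

/-- With an auxiliary chart `χ` at the source of `h₀`, the matrix factors as those of `σ(g, h)`, of
`T(gh)` and the inverse of that of `T(h)`. Each factor is continuous for the operator norm. -/
theorem Pseudorep.tendsto_localMatrix_quotient {φ ψ : LocalTrivialization A E V}
    (hφ : φ ∈ S.atlas) (hψ : ψ ∈ S.atlas) {P : Type*} {l : Filter P} {x y z : P → X}
    {g : ∀ p, y p ⟶ z p} {h : ∀ p, x p ⟶ y p} {x₀ y₀ z₀ : X} {g₀ : y₀ ⟶ z₀} {h₀ : x₀ ⟶ y₀}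
    (hg : TendstoArr l g g₀) (hh : TendstoArr l h h₀) (hy₀ : y₀ ∈ φ.baseSet)
    (hz₀ : z₀ ∈ ψ.baseSet) :
    Tendsto (fun p => (ψ.coordSymm (z p)).comp
      ((T.quotient σ (g p) (h p)).comp (φ.coord (y p)))) l
      (𝓝 ((ψ.coordSymm z₀).comp ((T.quotient σ g₀ h₀).comp (φ.coord y₀)))) := by
  obtain ⟨χ, hχ, hx₀⟩ := S.covers x₀
  have hinv := fun {x y : X} (g : x ⟶ y) =>
    Pseudorep.isInvertible hE.completeSpace hT.defect_le g
  have key : ∀ {x y z : X} (g : y ⟶ z) (h : x ⟶ y), x ∈ χ.baseSet → y ∈ φ.baseSet →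
      z ∈ ψ.baseSet →
      ((ψ.coordSymm z).comp (((σ g h : A z) • ContinuousLinearMap.id ℝ (E z)).comp
        (ψ.coord z))).comp ((T.localMatrix χ ψ (h ≫ g)).comp (T.localMatrix χ φ h).inverse) =
      (ψ.coordSymm z).comp ((T.quotient σ g h).comp (φ.coord y)) := by
    intro x y z g h hx hy hz
    have e1 : (T.localMatrix χ φ h).inverse =
        (χ.coordSymm x).comp ((T h).inverse.comp (φ.coord y)) := by
      rw [Pseudorep.localMatrix, χ.coord_of_mem hx, χ.coordSymm_of_mem hx, φ.coord_of_mem hy,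
        φ.coordSymm_of_mem hy, inverse_conj _ _ (hinv h)]
    rw [e1]
    ext v
    simp only [Pseudorep.localMatrix, ContinuousLinearMap.comp_apply,
      χ.coord_coordSymm hx, ψ.coord_coordSymm hz]
    rfl
  have hc : ContinuousAt ContinuousLinearMap.inverse (T.localMatrix χ φ h₀) := by
    obtain ⟨e, he⟩ := hinv h₀
    rw [Pseudorep.localMatrix, χ.coord_of_mem hx₀, φ.coordSymm_of_mem hy₀, ← he]
    exact (contDiffAt_map_inverse (𝕜 := ℝ) (n := 0)
      (((χ.equiv ⟨x₀, hx₀⟩).trans e).trans (φ.equiv ⟨y₀, hy₀⟩).symm)).continuousAt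
  have h1 := ψ.tendsto_scalar hA.toIsBanachBundle hz₀ (σ.tendsto hg hh)
  have h2 := hTS.tendsto_localMatrix hG hχ hψ (hG.tendsto_comp hg hh) hx₀ hz₀
  have h3 := hc.tendsto.comp (hTS.tendsto_localMatrix hG hχ hφ hh hx₀ hy₀)
  rw [← key g₀ h₀ hx₀ hy₀ hz₀]
  refine (tendsto_clm_comp h1 (tendsto_clm_comp h2 h3)).congr' ?_
  filter_upwards [hG.tendsto_source hh (χ.isOpen_baseSet.mem_nhds hx₀),
    hG.tendsto_target hh (φ.isOpen_baseSet.mem_nhds hy₀),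
    hG.tendsto_target hg (ψ.isOpen_baseSet.mem_nhds hz₀)] with p hpx hpy hpz
  exact key _ _ hpx hpy hpz

/-- In charts the integrands are norm continuous, so the vectorwise average coincides with a Bochner
integral of operators on `V`. Its continuity is the integral lemma for constant sections. -/
theorem Pseudorep.isUniformlyContinuous_average [T2Space X] [T2Space (Arr X)]
    [LocallyCompactSpace (Arr X)] (ν : InvariantMean X) {R : Pseudorep E}
    (hR : ∀ ⦃x y : X⦄ (g : x ⟶ y) (e : E x),
      R g e = ∫ h, T.quotient σ g h.hom e ∂(ν.measure x)) : R.IsUniformlyContinuous S := by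
  refine Pseudorep.isUniformlyContinuous_of_continuousAt hG fun φ hφ ψ hψ g₀ hx₀ hy₀ => ?_
  have hcont : ∀ {x y : X} (g : x ⟶ y), x ∈ φ.baseSet → y ∈ ψ.baseSet →
      Continuous fun h : TargetFiber X x =>
        (ψ.coordSymm y).comp ((T.quotient σ g h.hom).comp (φ.coord x)) := by
    intro x y g hx hy
    refine continuous_iff_continuousAt.2 fun h => ?_
    exact Pseudorep.tendsto_localMatrix_quotient hG hA hE hT hTS hφ hψ (g := fun _ => g)
      (h := fun h : TargetFiber X x => h.hom) tendsto_const_nhds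
      ((TargetFiber.continuous_toArr x).tendsto h) hx hy
  have hint : ∀ {x y : X} (g : x ⟶ y), x ∈ φ.baseSet → y ∈ ψ.baseSet →
      ∫ h : TargetFiber X x, (ψ.coordSymm y).comp ((T.quotient σ g h.hom).comp (φ.coord x))
        ∂(ν.measure x) = R.localMatrix φ ψ g := by
    intro x y g hx hy
    have := hE.completeSpace y
    ext v
    rw [ContinuousLinearMap.integral_apply (ν.integrable hG (hcont g hx hy))]
    simp only [Pseudorep.localMatrix, ContinuousLinearMap.comp_apply]
    rw [hR, (ψ.coordSymm y).integral_comp_comm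
      (ν.integrable hG (Pseudorep.continuous_quotient hG hA hE hT g _))]
  have hev : ∀ᶠ g : Arr X in 𝓝 g₀, g.left ∈ φ.baseSet ∧ g.right ∈ ψ.baseSet :=
    ((φ.isOpen_baseSet.preimage hG.continuous_source).inter
      (ψ.isOpen_baseSet.preimage hG.continuous_target)).mem_nhds ⟨hx₀, hy₀⟩
  have key := ν.tendsto_integral hG (hG.continuous_source.tendsto g₀)
    (isAsymptoticallyLinear_const (𝓝 g₀) (V →L[ℝ] V))
    (f := fun g h => (ψ.coordSymm g.right).comp
      ((T.quotient σ g.hom h.hom).comp (φ.coord g.left)))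
    (hev.mono fun g hg => hcont g.hom hg.1 hg.2) (hcont g₀.hom hx₀ hy₀) fun h₀ => ?_
  · rw [ContinuousAt, tendsto_iff_norm_sub_tendsto_zero]
    refine key.congr' ?_
    filter_upwards [hev] with g hg
    rw [hint g.hom hg.1 hg.2, hint g₀.hom hx₀ hy₀]
  · rw [← tendsto_iff_norm_sub_tendsto_zero]
    have hc : Tendsto (fun p : Σ g : Arr X, TargetFiber X g.left => (p.1, p.2.toArr))
        (comap (fun p => (p.1, p.2.toArr)) (𝓝 g₀ ×ˢ 𝓝 h₀.toArr)) (𝓝 g₀ ×ˢ 𝓝 h₀.toArr) :=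
      tendsto_comap
    exact Pseudorep.tendsto_localMatrix_quotient hG hA hE hT hTS hφ hψ
      (g := fun p : Σ g : Arr X, TargetFiber X g.left => p.1.hom)
      (h := fun p : Σ g : Arr X, TargetFiber X g.left => p.2.hom) (g₀ := g₀.hom) (h₀ := h₀.hom)
      (tendsto_fst.comp hc) (tendsto_snd.comp hc) hx₀ hy₀

end

/-! ## Iterated averages -/

/-- From `b² r ≤ 1/9` one gets `r' ≤ (32/9) (b² r) r ≤ (32/81) r`, and `r ≤ 1/4` gives `b' ≤ (4/3)
b`. The new constants are then `32/81 < 3/5`, `(16/9)(32/81) = 512/729 < 1` and `(4/3)(32/81) =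
128/243 < 3/5`. -/
theorem enorm_average_estimates {b r b' r' : ℝ≥0∞} (hr : r ≤ 1 / 4) (hbr : b ^ 2 * r ≤ 1 / 9)
    (hb' : b' ≤ b + 4 / 3 * (b * r)) (hr' : r' ≤ 2 * (4 / 3 * (b * r)) ^ 2) :
    r' ≤ 3 / 5 * r ∧ b' ^ 2 * r' ≤ 1 / 9 ∧ b' * r' ≤ 3 / 5 * (b * r) := by
  have h0 : (2 : ℝ≥0∞) * (4 / 3) ^ 2 * (1 / 9) ≤ 3 / 5 := by
    rw [← ENNReal.toReal_le_toReal (by finiteness) (by finiteness)]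
    norm_num [ENNReal.toReal_mul]
  have h1 : (4 / 3 : ℝ≥0∞) * (2 * (4 / 3) ^ 2 * (1 / 9)) ≤ 3 / 5 := by
    rw [← ENNReal.toReal_le_toReal (by finiteness) (by finiteness)]
    norm_num [ENNReal.toReal_mul]
  have h2 : (4 / 3 : ℝ≥0∞) ^ 2 * (2 * (4 / 3) ^ 2 * (1 / 9)) ≤ 1 := by
    rw [← ENNReal.toReal_le_toReal (by finiteness) (by finiteness)]
    norm_num [ENNReal.toReal_mul]
  have h3 : (1 : ℝ≥0∞) + 4 / 3 * (1 / 4) ≤ 4 / 3 := by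
    rw [← ENNReal.toReal_le_toReal (by finiteness) (by finiteness),
      ENNReal.toReal_add (by finiteness) (by finiteness)]
    norm_num [ENNReal.toReal_mul]
  have hr'' : r' ≤ 2 * (4 / 3) ^ 2 * (1 / 9) * r := by
    refine hr'.trans ?_
    calc 2 * (4 / 3 * (b * r)) ^ 2 = 2 * (4 / 3) ^ 2 * (b ^ 2 * r) * r := by ring
      _ ≤ _ := by gcongr
  have hb'' : b' ≤ 4 / 3 * b := by
    refine hb'.trans ?_
    calc b + 4 / 3 * (b * r) = (1 + 4 / 3 * r) * b := by ring
      _ ≤ (1 + 4 / 3 * (1 / 4)) * b := by gcongr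
      _ ≤ _ := by gcongr
  refine ⟨hr''.trans (by gcongr), ?_, ?_⟩
  · calc b' ^ 2 * r' ≤ (4 / 3 * b) ^ 2 * (2 * (4 / 3) ^ 2 * (1 / 9) * r) := by gcongr
      _ = (4 / 3) ^ 2 * (2 * (4 / 3) ^ 2 * (1 / 9)) * (b ^ 2 * r) := by ring
      _ ≤ 1 * (1 / 9) := by gcongr
      _ = 1 / 9 := one_mul _
  · calc b' * r' ≤ 4 / 3 * b * (2 * (4 / 3) ^ 2 * (1 / 9) * r) := by gcongr
      _ = 4 / 3 * (2 * (4 / 3) ^ 2 * (1 / 9)) * (b * r) := by ring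
      _ ≤ _ := by gcongr

section

universe w

variable {X : Type*} [Groupoid X] [TopologicalSpace X] [TopologicalSpace (Arr X)]
  {A : X → Type*} [∀ x, NormedRing (A x)] [∀ x, NormOneClass (A x)] [∀ x, NormedAlgebra ℝ (A x)]
  [TopologicalSpace (Tot A)]
  {α : AlgebraAction A} {σ : Multiplier α}
  {E : X → Type*} [∀ x, NormedAddCommGroup (E x)] [∀ x, NormedSpace ℝ (E x)]
  [∀ x, Module (A x) (E x)] [∀ x, IsBoundedSMul (A x) (E x)]
  [∀ x, IsScalarTower ℝ (A x) (E x)] [TopologicalSpace (Tot E)]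

/-- `R` is as uniformly continuous as `T`. -/
def Pseudorep.PreservesUniformContinuity (A : X → Type*) [∀ x, NormedRing (A x)]
    [∀ x, NormedAlgebra ℝ (A x)] [TopologicalSpace (Tot A)] [∀ x, Module (A x) (E x)]
    [∀ x, IsBoundedSMul (A x) (E x)] [∀ x, IsScalarTower ℝ (A x) (E x)]
    (T R : Pseudorep E) : Prop :=
  ∀ (V : Type w) [NormedAddCommGroup V] [NormedSpace ℝ V] [CompleteSpace V]
    (S : GIStructure A E V), T.IsUniformlyContinuous S → R.IsUniformlyContinuous S

/-- One step of the iteration. -/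
structure Pseudorep.IsImprovement (σ : Multiplier α) (T R : Pseudorep E) : Prop where
  isNearRepresentation : R.IsNearRepresentation σ
  enorm_sub_le : ∀ ⦃x y : X⦄ (g : x ⟶ y),
    ‖R g - T g‖ₑ ≤ 4 / 3 * (T.bound σ y * T.defect σ y)
  defect_le : ∀ x, R.defect σ x ≤ 3 / 5 * T.defect σ x
  bound_mul_defect_le : ∀ x,
    R.bound σ x * R.defect σ x ≤ 3 / 5 * (T.bound σ x * T.defect σ x)
  preservesUniformContinuity : Pseudorep.PreservesUniformContinuity.{w} A T R

theorem Pseudorep.exists_isImprovement [T2Space X] [T2Space (Arr X)] [LocallyCompactSpace (Arr X)]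
    (hG : IsTopologicalGroupoid X) (ν : InvariantMean X) (hA : IsBanachAlgebraBundle A)
    (hE : IsBanachModuleBundle A E) {T : Pseudorep E} (hT : T.IsNearRepresentation σ) :
    ∃ R : Pseudorep E, Pseudorep.IsImprovement.{w} σ T R := by
  obtain ⟨R, hR⟩ := Pseudorep.exists_average hG hA hE hT ν
  have hsub := fun {x y : X} (g : x ⟶ y) => Pseudorep.enorm_average_sub_le hG hA hE hT ν hR g
  have hdefect : ∀ x, R.defect σ x ≤ 2 * (4 / 3 * (T.bound σ x * T.defect σ x)) ^ 2 := by
    refine fun x => R.defect_le_of_forall σ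
      (Pseudorep.average_id hE hT ν hR) fun w y z k g h => ?_
    rw [T.bound_congr σ k, T.defect_congr σ k]
    exact Pseudorep.enorm_average_comp_le hG hA hE hT ν hR g h
  have hbound : ∀ x, R.bound σ x ≤ T.bound σ x + 4 / 3 * (T.bound σ x * T.defect σ x) := by
    refine fun x => R.bound_le_of_forall σ fun y z k g => ?_
    rw [T.bound_congr σ k, T.defect_congr σ k]
    have h1 : ‖R g‖ₑ ≤ ‖T g‖ₑ + ‖R g - T g‖ₑ := by
      have := enorm_add_le (E := E y →L[ℝ] E z) (T g) (R g - T g)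
      rwa [add_sub_cancel] at this
    refine (mul_le_mul_right h1 _).trans ?_
    rw [mul_add]
    -- The distance estimate carries `1 / ℓ(σ, g)`, which offsets the weight in the bound.
    refine add_le_add (T.ell_mul_enorm_le_bound σ g) ((mul_le_mul_right (hsub g) _).trans ?_)
    exact ENNReal.mul_div_le
  have hest := fun x => enorm_average_estimates (hT.defect_le x) (hT.bound_sq_mul_defect_le x)
    (hbound x) (hdefect x)
  have h35 : (3 / 5 : ℝ≥0∞) ≤ 1 := by
    rw [← ENNReal.toReal_le_toReal (by finiteness) (by finiteness)]
    norm_num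
  refine ⟨R, ⟨Pseudorep.isLinear_average hG hA hE hT ν hR, fun x => ?_, fun x => (hest x).2.1⟩,
    fun x y g => ?_, fun x => (hest x).1, fun x => (hest x).2.2, fun V _ _ _ S hS =>
      Pseudorep.isUniformlyContinuous_average hG hA hE hT hS ν hR⟩
  · exact (hest x).1.trans ((mul_le_of_le_one_left' h35).trans (hT.defect_le x))
  · refine (hsub g).trans (ENNReal.div_le_of_le_mul ?_)
    exact le_mul_of_one_le_right' (Multiplier.one_le_ell g)

/-! ## Uniform limits -/

theorem tendsto_clm_apply {P : Type*} {l : Filter P} {V W : Type*} [NormedAddCommGroup V]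
    [NormedSpace ℝ V] [NormedAddCommGroup W] [NormedSpace ℝ W] {f : P → V →L[ℝ] W} {v : P → V}
    {f₀ : V →L[ℝ] W} {v₀ : V} (hf : Tendsto f l (𝓝 f₀)) (hv : Tendsto v l (𝓝 v₀)) :
    Tendsto (fun p => f p (v p)) l (𝓝 (f₀ v₀)) :=
  ((continuous_fst.clm_apply continuous_snd).tendsto (f₀, v₀)).comp (hf.prodMk_nhds hv)

/-- Uniform limits of pseudorepresentations are pseudorepresentations. -/
theorem Pseudorep.exists_of_uniform_limit (hG : IsTopologicalGroupoid X) (hE : IsBanachBundle E)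
    {T : ℕ → Pseudorep E} {R : ∀ x y : X, (x ⟶ y) → (E x →L[ℝ] E y)} {c : ℕ → ℝ}
    (hc : Tendsto c atTop (𝓝 0)) (hTR : ∀ n x y (g : x ⟶ y), ‖R x y g - T n g‖ ≤ c n) :
    ∃ R' : Pseudorep E, ∀ ⦃x y : X⦄ (g : x ⟶ y), R' g = R x y g := by
  refine ⟨⟨fun x y g => R x y g, ?_⟩, fun x y g => rfl⟩
  rw [continuous_iff_continuousAt]
  intro p₀
  obtain ⟨hg, he⟩ := tendsto_pull_iff.1 (tendsto_id : Tendsto id (𝓝 p₀) (𝓝 p₀))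
  replace hg : TendstoArr (𝓝 p₀) (fun p : Pull (fun g : Arr X => g.left) E => p.proj.hom)
    p₀.proj.hom := hg
  refine tendsto_pull_iff.2 ⟨hg, ?_⟩
  refine hE.tendsto_of_sections (hG.tendsto_target hg) fun Q q m s hq hs => ?_
  refine hE.tendsto_of_norm_sub (hs _) ?_
  rw [NormedAddGroup.tendsto_nhds_zero]
  intro ε hε
  set e₀ : E p₀.proj.left := vec p₀
  -- The usual three-`ε` argument; eventually `‖e‖ < ‖e₀‖ + 1`, so this `n` controls both uniform
  -- approximation errors.
  obtain ⟨n, hn⟩ : ∃ n, c n * (‖e₀‖ + 1) < ε / 3 := by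
    have h := hc.mul_const (‖e₀‖ + 1)
    rw [zero_mul] at h
    exact (h.eventually (gt_mem_nhds (by positivity))).exists
  have hc0 : 0 ≤ c n := (norm_nonneg _).trans (hTR n _ _ (𝟙 p₀.proj.left))
  have h1 := (hE.tendsto_norm (he.comp hq)).eventually (gt_mem_nhds (lt_add_one ‖e₀‖))
  have h2 := hE.tendsto_norm_sub ((T n).tendsto (hg.comp hq) (he.comp hq))
    (hs (T n p₀.proj.hom e₀))
  have h3 := (hE.isAsymptoticallyLinear hs).tendsto_norm_sub (T n p₀.proj.hom e₀)
    (R _ _ p₀.proj.hom e₀)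
  have h4 : ‖T n p₀.proj.hom e₀ - R _ _ p₀.proj.hom e₀‖ < ε / 3 := by
    rw [norm_sub_rev, ← sub_apply]
    refine (ContinuousLinearMap.le_of_opNorm_le _ (hTR n _ _ p₀.proj.hom) e₀).trans_lt
      (lt_of_le_of_lt ?_ hn)
    gcongr
    linarith
  filter_upwards [h1, h2.eventually (gt_mem_nhds (by positivity : 0 < ε / 3)),
    h3.eventually (gt_mem_nhds h4)] with i hi1 hi2 hi3
  rw [norm_norm]
  have h5 : ‖R _ _ (q i).proj.hom (vec (q i)) - T n (q i).proj.hom (vec (q i))‖ < ε / 3 := by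
    rw [← sub_apply]
    refine (ContinuousLinearMap.le_of_opNorm_le _ (hTR n _ _ (q i).proj.hom) _).trans_lt
      (lt_of_le_of_lt ?_ hn)
    exact mul_le_mul_of_nonneg_left hi1.le hc0
  have h6 := norm_sub_le_norm_sub_add_norm_sub (R _ _ (q i).proj.hom (vec (q i)))
    (T n (q i).proj.hom (vec (q i))) (s (R _ _ p₀.proj.hom e₀) i)
  have h7 := norm_sub_le_norm_sub_add_norm_sub (T n (q i).proj.hom (vec (q i)))
    (s (T n p₀.proj.hom e₀) i) (s (R _ _ p₀.proj.hom e₀) i)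
  have hi2' : ‖T n (q i).proj.hom (vec (q i)) - s (T n p₀.proj.hom e₀) i‖ < ε / 3 := hi2
  refine lt_of_le_of_lt (h6.trans (add_le_add_right h7 _)) ?_
  linarith

-- The charts of the structure are isometric, so the matrices in these charts converge uniformly
-- whenever the operators do.
omit [∀ x, NormOneClass (A x)] in
theorem Pseudorep.isUniformlyContinuous_of_uniform_limit (hG : IsTopologicalGroupoid X)
    {T : ℕ → Pseudorep E} {R : Pseudorep E} {c : ℕ → ℝ} (hc : Tendsto c atTop (𝓝 0))
    (hTR : ∀ n ⦃x y : X⦄ (g : x ⟶ y), ‖R g - T n g‖ ≤ c n) {V : Type*} [NormedAddCommGroup V]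
    [NormedSpace ℝ V] [CompleteSpace V] {S : GIStructure A E V}
    (hS : ∀ n, (T n).IsUniformlyContinuous S) : R.IsUniformlyContinuous S := by
  refine Pseudorep.isUniformlyContinuous_of_continuousAt hG fun φ hφ ψ hψ g₀ hx₀ hy₀ => ?_
  refine continuousAt_of_locally_uniform_approx_of_continuousAt fun u hu => ?_
  obtain ⟨ε, hε, hεu⟩ := Metric.mem_uniformity_dist.1 hu
  obtain ⟨n, hn⟩ := (hc.eventually (gt_mem_nhds hε)).exists
  refine ⟨univ, univ_mem, fun g => (T n).localMatrix φ ψ g.hom,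
    (hS n).tendsto_localMatrix hG hφ hψ tendsto_id hx₀ hy₀, fun g _ => hεu ?_⟩
  rw [dist_eq_norm]
  refine lt_of_le_of_lt ?_ hn
  have h1 : R.localMatrix φ ψ g.hom - (T n).localMatrix φ ψ g.hom =
      (ψ.coordSymm g.right).comp ((R g.hom - T n g.hom).comp (φ.coord g.left)) := by
    ext v
    simp [Pseudorep.localMatrix]
  rw [h1]
  refine (ContinuousLinearMap.opNorm_comp_le _ _).trans ?_
  refine (mul_le_of_le_one_left (norm_nonneg _) (S.norm_coordSymm_le hψ _)).trans ?_
  refine (ContinuousLinearMap.opNorm_comp_le _ _).trans ?_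
  exact (mul_le_of_le_one_right (norm_nonneg _) (S.norm_coord_le hφ _)).trans (hTR n g.hom)

omit [TopologicalSpace X] [∀ x, NormOneClass (A x)] in
theorem Pseudorep.isRepresentation_of_limit {T : ℕ → Pseudorep E} {R : Pseudorep E}
    (hTR : ∀ ⦃x y : X⦄ (g : x ⟶ y), Tendsto (fun n => T n g) atTop (𝓝 (R g)))
    (hlin : ∀ n, (T n).IsLinear α)
    (hdefect : ∀ x, Tendsto (fun n => (T n).defect σ x) atTop (𝓝 0)) : R.IsRepresentation σ := by
  have happ : ∀ {x y : X} (g : x ⟶ y) (e : E x), Tendsto (fun n => T n g e) atTop (𝓝 (R g e)) :=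
    fun g e => tendsto_clm_apply (hTR g) tendsto_const_nhds
  have hzero : ∀ {x y z : X} {f : ℕ → E x →L[ℝ] E y}, (∀ n, ‖f n‖ₑ ≤ (T n).defect σ z) →
      ∀ e, Tendsto (fun n => f n e) atTop (𝓝 0) := by
    intro x y z f hf e
    have h1 : Tendsto (fun n => ‖f n‖ₑ) atTop (𝓝 0) :=
      tendsto_of_tendsto_of_tendsto_of_le_of_le tendsto_const_nhds (hdefect z)
        (fun _ => zero_le) hf
    have h2 : Tendsto f atTop (𝓝 0) := by
      rw [tendsto_zero_iff_norm_tendsto_zero]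
      have h3 := (ENNReal.tendsto_toReal ENNReal.zero_ne_top).comp h1
      simpa only [Function.comp_def, toReal_enorm, ENNReal.toReal_zero] using h3
    simpa using tendsto_clm_apply h2 (tendsto_const_nhds (x := e))
  refine ⟨fun x y g a e => ?_, fun x => ?_, fun x y z g h => ?_⟩
  · refine tendsto_nhds_unique (happ g (a • e)) ?_
    simp_rw [hlin _ g a e]
    exact (happ g e).const_smul _
  · ext e
    have h1 := hzero (z := x) (f := fun n => ContinuousLinearMap.id ℝ (E x) - T n (𝟙 x))
      (fun n => le_self_add.trans ((T n).add_le_defect σ (𝟙 x) (𝟙 x))) e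
    have h2 : Tendsto (fun n => e - T n (𝟙 x) e) atTop (𝓝 (e - R (𝟙 x) e)) :=
      tendsto_const_nhds.sub (happ (𝟙 x) e)
    exact (sub_eq_zero.1 (tendsto_nhds_unique h2 h1)).symm
  · ext e
    have h1 := hzero (z := z)
      (f := fun n => (σ g h : A z) • T n (h ≫ g) - (T n g).comp (T n h))
      (fun n => (le_mul_of_one_le_left' (Multiplier.one_le_ell g)).trans
        ((T n).ell_mul_le_defect σ g h)) e
    have h2 : Tendsto (fun n => (σ g h : A z) • T n (h ≫ g) e - T n g (T n h e)) atTop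
        (𝓝 ((σ g h : A z) • R (h ≫ g) e - R g (R h e))) :=
      ((happ (h ≫ g) e).const_smul _).sub (tendsto_clm_apply (hTR g) (happ h e))
    exact sub_eq_zero.1 (tendsto_nhds_unique h2 h1)

omit [TopologicalSpace X] [∀ x, NormOneClass (A x)] in
theorem Pseudorep.IsRepresentation.defect_eq_zero {R : Pseudorep E} (hR : R.IsRepresentation σ)
    (x : X) : R.defect σ x = 0 := by
  refine le_antisymm (R.defect_le_of_forall σ hR.map_id fun w y z _ g h => ?_) zero_le
  have h0 : ‖(0 : E w →L[ℝ] E z)‖ₑ = 0 := enorm_zero (E := E w →L[ℝ] E z)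
  rw [hR.map_comp, sub_self, h0, mul_zero]

/-! ## Almost representations are close to representations -/

theorem Pseudorep.IsNearRepresentation.exists_isRepresentation [T2Space X] [T2Space (Arr X)]
    [LocallyCompactSpace (Arr X)] (hG : IsTopologicalGroupoid X) (ν : InvariantMean X)
    (hA : IsBanachAlgebraBundle A) (hE : IsBanachModuleBundle A E) {T : Pseudorep E}
    (hT : T.IsNearRepresentation σ) :
    ∃ R : Pseudorep E, R.IsRepresentation σ ∧ IsHomeomorph R.totalMap ∧
      (∀ ⦃x y : X⦄ (g : x ⟶ y), ‖R g - T g‖ₑ ≤ 4 * T.bound σ y * T.defect σ y) ∧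
      Pseudorep.PreservesUniformContinuity.{w} A T R := by
  have hstep : ∀ T : {T : Pseudorep E // T.IsNearRepresentation σ},
      ∃ R : {T : Pseudorep E // T.IsNearRepresentation σ},
        Pseudorep.IsImprovement.{w} σ T.1 R.1 := fun T => by
    obtain ⟨R, hR⟩ := Pseudorep.exists_isImprovement hG ν hA hE T.2
    exact ⟨⟨R, hR.isNearRepresentation⟩, hR⟩
  choose F hF using hstep
  let T' : ℕ → {T : Pseudorep E // T.IsNearRepresentation σ} := fun n => F^[n] ⟨T, hT⟩
  have hT' : ∀ n, Pseudorep.IsImprovement.{w} σ (T' n).1 (T' (n + 1)).1 := fun n => by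
    simp only [T', Function.iterate_succ_apply']
    exact hF _
  have hdefect : ∀ n x, (T' n).1.defect σ x ≤ (3 / 5) ^ n * T.defect σ x := by
    intro n x
    induction n with
    | zero => simp [T']
    | succ n ih =>
      refine ((hT' n).defect_le x).trans ((mul_le_mul_right ih _).trans ?_)
      rw [pow_succ', mul_assoc]
  have hbd : ∀ n x, (T' n).1.bound σ x * (T' n).1.defect σ x ≤
      (3 / 5) ^ n * (T.bound σ x * T.defect σ x) := by
    intro n x
    induction n with
    | zero => simp [T']
    | succ n ih =>
      refine ((hT' n).bound_mul_defect_le x).trans ((mul_le_mul_right ih _).trans ?_)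
      rw [pow_succ', mul_assoc]
  let D : X → ℝ := fun x => (T.bound σ x * T.defect σ x).toReal
  have hDtop : ∀ x, T.bound σ x * T.defect σ x ≠ ∞ := fun x =>
    ((hT.bound_mul_defect_le x).trans_lt (by finiteness)).ne
  have hD : ∀ x, D x ≤ 1 / 4 := fun x => by
    simpa [D] using ENNReal.toReal_mono (by finiteness) (hT.bound_mul_defect_le x)
  have hdist : ∀ {x y : X} (g : x ⟶ y) n,
      dist ((T' n).1 g) ((T' (n + 1)).1 g) ≤ 4 / 3 * D y * (3 / 5) ^ n := by
    intro x y g n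
    rw [dist_comm, dist_eq_norm, ← toReal_enorm]
    have h1 := ((hT' n).enorm_sub_le g).trans (mul_le_mul_right (hbd n y) _)
    have h2 := ENNReal.toReal_mono (by have := hDtop y; finiteness) h1
    refine h2.trans (le_of_eq ?_)
    simp only [ENNReal.toReal_mul, ENNReal.toReal_div, ENNReal.toReal_pow, ENNReal.toReal_ofNat, D]
    ring
  have hlim : ∀ (x y : X) (g : x ⟶ y), ∃ R : E x →L[ℝ] E y,
      Tendsto (fun n => (T' n).1 g) atTop (𝓝 R) := by
    intro x y g
    have := hE.completeSpace y
    exact cauchySeq_tendsto_of_complete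
      (cauchySeq_of_le_geometric _ _ (by norm_num) (hdist g))
  choose R₀ hR₀ using hlim
  -- The tail of the geometric series is at most `(4/3)(1/4)(5/2) = 5/6` times `(3/5)^n`. The
  -- numerical bound on `b r` makes the convergence uniform over all orbits.
  have hclose : ∀ n x y (g : x ⟶ y), ‖R₀ x y g - (T' n).1 g‖ ≤ (3 / 5) ^ n := by
    intro n x y g
    rw [← dist_eq_norm, dist_comm]
    refine (dist_le_of_le_geometric_of_tendsto _ _ (by norm_num) (hdist g) (hR₀ x y g) n).trans ?_
    have h1 := hD y
    have h2 : (0 : ℝ) < (3 / 5) ^ n := by positivity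
    rw [div_le_iff₀ (by norm_num)]
    nlinarith
  have hgeom : Tendsto (fun n : ℕ => (3 / 5 : ℝ) ^ n) atTop (𝓝 0) :=
    tendsto_pow_atTop_nhds_zero_of_lt_one (by norm_num) (by norm_num)
  obtain ⟨R, hR⟩ := Pseudorep.exists_of_uniform_limit hG hE.toIsBanachBundle hgeom hclose
  have hrep : R.IsRepresentation σ := by
    refine Pseudorep.isRepresentation_of_limit (T := fun n => (T' n).1)
      (fun x y g => by rw [hR]; exact hR₀ x y g) (fun n => (T' n).2.isLinear) fun x => ?_
    have h35 : (3 / 5 : ℝ≥0∞) < 1 := by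
      rw [← ENNReal.toReal_lt_toReal (by finiteness) (by finiteness)]
      norm_num
    have h1 := ENNReal.Tendsto.mul_const (b := T.defect σ x)
      (ENNReal.tendsto_pow_atTop_nhds_zero_of_lt_one h35)
      (.inr ((hT.defect_le x).trans_lt (by finiteness)).ne)
    rw [zero_mul] at h1
    exact tendsto_of_tendsto_of_tendsto_of_le_of_le tendsto_const_nhds h1
      (fun _ => zero_le) fun n => hdefect n x
  -- The limit has defect zero, so the invertibility results apply to `R` itself.
  refine ⟨R, hrep, Pseudorep.isHomeomorph_totalMap hG hA hE (σ := σ)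
    (fun x => by rw [hrep.defect_eq_zero]; exact zero_le), fun x y g => ?_,
    fun V _ _ _ S hS => ?_⟩
  -- Summing all steps gives `(4/3) / (1 - 3/5) = 10/3`, which is below `4`.
  · have h1 : ‖R g - T g‖ ≤ 4 * D y := by
      rw [hR, ← dist_eq_norm, dist_comm]
      refine (dist_le_of_le_geometric_of_tendsto₀ _ _ (by norm_num) (hdist g)
        (hR₀ x y g)).trans ?_
      rw [div_le_iff₀ (by norm_num)]
      have : 0 ≤ D y := ENNReal.toReal_nonneg
      linarith
    rw [mul_assoc, ← ENNReal.ofReal_toReal (hDtop y), ← ENNReal.ofReal_ofNat 4,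
      ← ENNReal.ofReal_mul (by norm_num), ← ofReal_norm]
    exact ENNReal.ofReal_le_ofReal h1
  · have hS' : ∀ n, (T' n).1.IsUniformlyContinuous S := by
      intro n
      induction n with
      | zero => exact hS
      | succ n ih => exact (hT' n).preservesUniformContinuity V S ih
    exact Pseudorep.isUniformlyContinuous_of_uniform_limit hG hgeom
      (fun n x y g => by rw [hR]; exact hclose n x y g) hS'

end

end

end GroupoidRep

open GroupoidRep
theorem mainTheorem1 {X : Type*} [Groupoid X] [TopologicalSpace X] [TopologicalSpace (Arr X)]
    [MeasurableSpace (Arr X)] [BorelSpace (Arr X)] (hG : IsProperGroupoid X)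
    {A : X → Type*} [∀ x, NormedRing (A x)] [∀ x, NormOneClass (A x)]
    [∀ x, NormedAlgebra ℝ (A x)] [TopologicalSpace (Tot A)] (hA : IsBanachAlgebraBundle A)
    (α : AlgebraAction A) (σ : Multiplier α)
    {E : X → Type*} [∀ x, NormedAddCommGroup (E x)] [∀ x, NormedSpace ℝ (E x)]
    [∀ x, Module (A x) (E x)] [∀ x, IsBoundedSMul (A x) (E x)]
    [∀ x, IsScalarTower ℝ (A x) (E x)] [TopologicalSpace (Tot E)]
    (hE : IsBanachModuleBundle A E)
    (T : Pseudorep E) (hT : T.IsAlmostRepresentation σ) :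
    (∃ R : Pseudorep E, R.IsRepresentation σ ∧ IsHomeomorph R.totalMap ∧
      ∀ ⦃x y : X⦄ (g : x ⟶ y), ‖R g - T g‖ₑ ≤ 4 * T.bound σ y * T.defect σ y) ∧
    ∀ (V : Type*) [NormedAddCommGroup V] [NormedSpace ℝ V] [CompleteSpace V]
      (S : GIStructure A E V), T.IsUniformlyContinuous S →
      ∃ R : Pseudorep E, R.IsRepresentation σ ∧ IsHomeomorph R.totalMap ∧
        (∀ ⦃x y : X⦄ (g : x ⟶ y), ‖R g - T g‖ₑ ≤ 4 * T.bound σ y * T.defect σ y) ∧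
        R.IsUniformlyContinuous S := by
  have := hE.t2Space_base
  have := hG.t2Space
  have := hG.locallyCompactSpace
  obtain ⟨ν⟩ := hG.nonempty_invariantMean
  obtain ⟨R, hR, hRh, hRT, hRS⟩ := hT.isNearRepresentation.exists_isRepresentation
    hG.toIsTopologicalGroupoid ν hA hE
  exact ⟨⟨R, hR, hRh, hRT⟩, fun V _ _ _ S hS => ⟨R, hR, hRh, hRT, hRS V S hS⟩⟩
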